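/- **Setting.** Let $m\ge 2$ agents be the vertices of a connected undirected graph $\mathcal G$. Agent $i$ holds a differentiable function $f_i:\mathbb R^d\to\mathbb R$ that is $\mu$-strongly convex and $L$-smooth, $\mu>0$, i.e. for all $x,y$ $$f_i(x)+\langle\nabla f_i(x),y-x\rangle+\tfrac{\mu}{2}\|y-x\|^2\le f_i(y)\le f_i(x)+\langle\nabla f_i(x),y-x\rangle+\tfrac{L}{2}\|y-x\|^2 .$$ Let $B\in\mathbb R^{p\times d}$ with $B\neq0$ and $\ker B\ne\{0\}$, and let $W\in\mathbb R^{m\times m}$ be symmetric positive semidefinite with $W_{ij}=0$ whenever $i\ne j$ are not adjacent and $\ker W=\mathrm{span}\{\mathbf 1\}$. Put $\mathbf W=W\otimes I_d$, $\mathbf B=I_m\otimes B$, $F(\mathbf x)=\sum_i f_i(x_i)$ for $\mathbf x=\mathrm{col}(x_1,\dots,x_m)$, and consider $$\min_{\mathbf x\in\mathbb R^{md}}F(\mathbf x)\quad\text{s.t. }\mathbf W\mathbf x=0,\ \mathbf B\mathbf x=0 .$$ For symmetric positive semidefinite $M\neq0$ let $\lambda_{\max}(M)$ and $\lambda^+_{\min}(M)$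 be its largest and smallest nonzero eigenvalues and $\chi(M)=\lambda_{\max}(M)/\lambda_{\min}^+(M)$. For $\gamma>0$ let $\mathbf A=\binom{\mathbf B}{\gamma\mathbf W}$, let $F^*(\mathbf q)=\sup_{\mathbf x}(\langle\mathbf q,\mathbf x\rangle-F(\mathbf x))$, $\Phi(\mathbf y)=\sup_{\mathbf x}\{-F(\mathbf x)+\langle\mathbf y,\mathbf A\mathbf x\rangle\}$ and $\mathbf x(\mathbf q)=\nabla F^*(\mathbf q)$. Let $\gamma_*=\sqrt{\lambda^+_{\min}(B^\top B)}/\lambda^+_{\min}(W)$. *Methods.* For symmetric positive semidefinite $\mathbf H\in\mathbb R^{md\times md}$ put $\eta=\mu/\lambda_{\max}(\mathbf H)$ and $\beta=\frac{\sqrt{\lambda_{\max}(\mathbf H)/\mu}-\sqrt{\lambda_{\min}^+(\mathbf H)/L}}{\sqrt{\lambda_{\max}(\mathbf H)/\mu}+\sqrt{\lambda_{\min}^+(\mathbf H)/L}}$. The fast dual method is $\mathbf y^{-1}=\mathbf y^0$, $\mathbf z=\mathbf y^k+\beta(\mathbf y^k-\mathbf y^{k-1})$, $\mathbf y^{k+1}=\mathbf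 z-\eta\nabla\Phi(\mathbf z)$, with $\mathbf H=\mathbf A^\top\mathbf A$. The globally dual method with matrix $\mathbf H$ is $\mathbf p^{-1}=\mathbf p^0$, $\mathbf q=\mathbf p^k+\beta(\mathbf p^k-\mathbf p^{k-1})$, $\mathbf p^{k+1}=\mathbf q-\eta\mathbf H\,\mathbf x(\mathbf q)$. *Chebyshev acceleration.* With $a=\lambda^+_{\min}(M)$, $b=\lambda_{\max}(M)$, $K=\lceil\sqrt{\chi(M)}\rceil$ and $T_K$ the Chebyshev polynomial, let $P_M(t)=1-T_K\!\big(\tfrac{b+a-2t}{b-a}\big)/T_K\!\big(\tfrac{b+a}{b-a}\big)$ if $a<b$, and $P_M(t)=t/b$ if $a=b$; put $\widehat M=P_M(M)$. The accelerated method is the globally dual method with $\widehat{\mathbf H}=I_m\otimes\widehat{B^\top B}+\widehat\gamma^2\,\widehat W^2\otimes I_d$, $\widehat\gamma^2=\lambda^+_{\min}(\widehat{B^\top B})/\lambda^+_{\min}(\widehat W)^2$. *Cost.* Every node stores vectors of $\mathbb R^d$ and $\mathbb R^p$, initially only its own blocks of the starting point, and forms linear combinations of stored vectors for free. One oracle call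 lets each node $i$ evaluate $\nabla f_i^*$ at one stored vector; one communication lets each node send one stored vector to all its neighbours; one multiplication lets each node multiply one stored vector by $B$ or $B^\top$. *Accuracy.* $\mathbf x$ is an $\varepsilon$-solution if $F(\mathbf x)-F(\mathbf x')\le\varepsilon$ for every feasible $\mathbf x'$, and $\|\mathbf A\mathbf x\|\le\varepsilon$. For a solution $\mathbf x^*$ and a start $\mathbf p^0$ let $r=\|\mathbf p^0-\nabla F(\mathbf x^*)\|/\mu$ and $$D_\gamma(\mathbf p^0)=3+\sqrt{\lambda_{\max}(\mathbf A^\top\mathbf A)}\,r+\|\nabla F(\mathbf x^*)\|\,r+L r^2 .$$ **Claim.** There is a universal constant $C>0$ such that for every such problem a solution $\mathbf x^*$ exists and the following hold. 1. $\mathbf x(\mathbf q)$ is the unique maximizer of $\langle\mathbf q,\mathbf x\rangle-F(\mathbf x)$. For every $\gamma>0$ the supremum defining $\Phi$ is attained, $\Phi(\mathbf y)=F^*(\mathbf A^\top\mathbf y)$, $\nabla\Phi(\mathbf y)=\mathbf A\,\mathbf x(\mathbf A^\top\mathbf y)$, and $\Phi$ is $\frac{\lambda_{\max}(\mathbf A^\top\mathbf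 A)}{\mu}$-smooth on the whole space and $\frac{\lambda_{\min}^+(\mathbf A^\top\mathbf A)}{L}$-strongly convex on $(\ker\mathbf A^\top)^\perp$. 2. For every $\gamma>0$, $\mathbf y^0$, $\varepsilon\in(0,1)$ and every $k\ge C\sqrt{L/\mu}\,\sqrt{\chi(\mathbf A^\top\mathbf A)}\,\log(D_\gamma(\mathbf A^\top\mathbf y^0)/\varepsilon)$, the fast dual method satisfies $\Phi(\mathbf y^k)-\inf\Phi\le\varepsilon$. Moreover $\eta>0$, $\beta\in(0,1)$, and $\mathbf p^k=\mathbf A^\top\mathbf y^k$ are the iterates of the globally dual method with $\mathbf H=\mathbf A^\top\mathbf A$ started at $\mathbf A^\top\mathbf y^0$. 3. For every $\gamma>0$, $\chi(\mathbf A^\top\mathbf A)=\dfrac{\lambda_{\max}(B^\top B)+\gamma^2\lambda_{\max}(W)^2}{\min\{\lambda_{\min}^+(B^\top B),\gamma^2\lambda_{\min}^+(W)^2\}}$; over $\gamma>0$ it is minimal at $\gamma_*>0$, with value $\chi(B^\top B)+\chi(W)^2$. From now on $\gamma=\gamma_*$ and $0<\varepsilon<1$. 4. For every $\mathbf y^0$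 there is $N$ such that $\mathbf x(\mathbf A^\top\mathbf y^k)$ is an $\varepsilon$-solution for all $k\ge N$, and $\mathbf x(\mathbf A^\top\mathbf y^N)$ can be computed so that $N$ and the numbers of oracle calls, of communications and of multiplications by $B,B^\top$ are each at most $$C\sqrt{\tfrac L\mu}\,\sqrt{\chi(B^\top B)+\chi(W)^2}\,\log\frac{D_\gamma(\mathbf A^\top\mathbf y^0)}{\varepsilon}.$$ 5. For $M\in\{W,B^\top B\}$ we have $\deg P_M\le C\sqrt{\chi(M)}$ and $\chi(\widehat M)\le C$. The accelerated method has $\eta>0$ and $\beta\in(0,1)$, and for every $\mathbf p^0\in\mathrm{range}\,\mathbf A^\top$ there is $N$ such that $\mathbf x(\mathbf p^k)$ is an $\varepsilon$-solution for all $k\ge N$, and $\mathbf x(\mathbf p^N)$ can be computed with $N_{\rm or}$ oracle calls at each node, at most $C N_{\rm or}\sqrt{\chi(W)}$ communications and at most $C N_{\rm or}\sqrt{\chi(B^\top B)}$ multiplications by $B,B^\top$ at each node, where $$\max\{N,N_{\rm or}\}\le C\sqrt{\tfrac L\mu}\,\log\frac{D_\gamma(\mathbf p^0)}{\varepsilon}.$$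 -/

import Mathlib

open scoped Kronecker Gradient RealInnerProductSpace

noncomputable section

namespace GloballyDual

/-- Column vectors with the Euclidean norm. -/
abbrev Vec (ι : Type) : Type := EuclideanSpace ℝ ι

/-! ### Spectral quantities of a symmetric positive semidefinite matrix -/

section Spectral

variable {n : Type} [Fintype n] [DecidableEq n]

/-- The maximal eigenvalue. -/
def lamMax (M : Matrix n n ℝ) : ℝ := sSup (spectrum ℝ M)

/-- The minimal nonzero eigenvalue. -/
def lamMinPos (M : Matrix n n ℝ) : ℝ := sInf {l | l ∈ spectrum ℝ M ∧ l ≠ 0}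

/-- The condition number `χ`. -/
def chi (M : Matrix n n ℝ) : ℝ := lamMax M / lamMinPos M

end Spectral

/-! ### Convex analysis -/

section Convex

variable {E : Type} [NormedAddCommGroup E] [InnerProductSpace ℝ E] [CompleteSpace E]

def IsSmooth (L : ℝ) (f : E → ℝ) : Prop :=
  Differentiable ℝ f ∧ ∀ x y : E, f y ≤ f x + ⟪∇ f x, y - x⟫ + L / 2 * ‖y - x‖ ^ 2

def IsStronglyConvexOn (s : Set E) (μ : ℝ) (f : E → ℝ) : Prop :=
  Differentiable ℝ f ∧
    ∀ x ∈ s, ∀ y ∈ s, f x + ⟪∇ f x, y - x⟫ + μ / 2 * ‖y - x‖ ^ 2 ≤ f y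

/-- The convex conjugate `f*(q) = sup_x (⟨q, x⟩ - f x)`. -/
def conjugate (f : E → ℝ) (q : E) : ℝ := ⨆ x : E, (⟪q, x⟫ - f x)

/-- The dual oracle `∇f*(q)`. -/
def dualOracle (f : E → ℝ) (q : E) : E := ∇ (conjugate f) q

/-- Nesterov's method with constant step `η` and constant momentum `β` for the gradient map `g`.
The `k`-th value is the pair `(y^k, y^{k-1})`, with `y^{-1} = y^0`. -/
def accel (g : E → E) (η β : ℝ) (y₀ : E) : ℕ → E × E
  | 0 => (y₀, y₀)
  | k + 1 =>
    let s := accel g η β y₀ k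
    let z := s.1 + β • (s.1 - s.2)
    (z - η • g z, s.1)

end Convex

/-! ### The decentralized problem with affine constraints -/

/-- The data: `m` agents with local objectives on `ℝ^d`, a graph, a gossip matrix `W`, a `p × d`
constraint matrix `B`, and the strong convexity and smoothness constants. -/
structure Problem (m d p : ℕ) where
  graph : SimpleGraph (Fin m)
  W : Matrix (Fin m) (Fin m) ℝ
  B : Matrix (Fin p) (Fin d) ℝ
  f : Fin m → Vec (Fin d) → ℝ
  μ : ℝ
  L : ℝ

structure Problem.Assumptions {m d p : ℕ} (P : Problem m d p) : Prop where
  two_le : 2 ≤ m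
  connected : P.graph.Connected
  posSemidef : P.W.PosSemidef
  compatible : ∀ i j, i ≠ j → ¬ P.graph.Adj i j → P.W i j = 0
  kernel : ∀ v : Fin m → ℝ, P.W.mulVec v = 0 ↔ ∀ i j, v i = v j
  B_ne_zero : P.B ≠ 0
  ker_B : ∃ x : Fin d → ℝ, x ≠ 0 ∧ P.B.mulVec x = 0
  μ_pos : 0 < P.μ
  smooth : ∀ i, IsSmooth P.L (P.f i)
  strong : ∀ i, IsStronglyConvexOn Set.univ P.μ (P.f i)

/-- The `i`-th block `x_i` of `x = col(x_1, …, x_m)`. -/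
def block {m n : ℕ} (x : Vec (Fin m × Fin n)) (i : Fin m) : Vec (Fin n) :=
  WithLp.toLp 2 fun j => x (i, j)

namespace Problem

variable {m d p : ℕ} (P : Problem m d p)

def F (x : Vec (Fin m × Fin d)) : ℝ := ∑ i, P.f i (block x i)

/-- `W ⊗ I_d`. -/
def bigW : Matrix (Fin m × Fin d) (Fin m × Fin d) ℝ :=
  P.W ⊗ₖ (1 : Matrix (Fin d) (Fin d) ℝ)

/-- `I_m ⊗ B`. -/
def bigB : Matrix (Fin m × Fin p) (Fin m × Fin d) ℝ :=
  (1 : Matrix (Fin m) (Fin m) ℝ) ⊗ₖ P.B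

def Feasible (x : Vec (Fin m × Fin d)) : Prop :=
  P.bigW.toEuclideanLin x = 0 ∧ P.bigB.toEuclideanLin x = 0

def IsSolution (x : Vec (Fin m × Fin d)) : Prop :=
  P.Feasible x ∧ ∀ z, P.Feasible z → P.F x ≤ P.F z

/-- The index type of the dual variable `y = (u, v)`, `u ∈ ℝ^{mp}`, `v ∈ ℝ^{md}`. -/
abbrev DualIdx (m d p : ℕ) : Type := (Fin m × Fin p) ⊕ (Fin m × Fin d)

/-- The matrix `A` with row blocks `I ⊗ B` and `γ (W ⊗ I)`. -/
def A (γ : ℝ) : Matrix (DualIdx m d p) (Fin m × Fin d) ℝ :=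
  Matrix.fromRows P.bigB (γ • P.bigW)

/-- `Aᵀ A`. -/
def gram (γ : ℝ) : Matrix (Fin m × Fin d) (Fin m × Fin d) ℝ :=
  (P.A γ).transpose * P.A γ

/-- `Bᵀ B`. -/
def BtB : Matrix (Fin d) (Fin d) ℝ := P.B.transpose * P.B

/-- The weight `γ` with `γ² = λ⁺_min(BᵀB) / λ⁺_min(W)²`. -/
def gammaOpt : ℝ := √(lamMinPos P.BtB) / lamMinPos P.W

/-- The dual function `Φ(y) = max_x (-F(x) + ⟨y, A x⟩)`. -/
def Phi (γ : ℝ) (y : Vec (DualIdx m d p)) : ℝ :=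
  ⨆ x : Vec (Fin m × Fin d), (-P.F x + ⟪y, (P.A γ).toEuclideanLin x⟫)

/-- The smoothness constant `λ_max(H)/μ` of `y ↦ F*(H^{1/2} y)`. -/
def dualL (H : Matrix (Fin m × Fin d) (Fin m × Fin d) ℝ) : ℝ := lamMax H / P.μ

/-- The strong convexity constant `λ⁺_min(H)/L` of `y ↦ F*(H^{1/2} y)` on `(ker H)^⊥`. -/
def dualMu (H : Matrix (Fin m × Fin d) (Fin m × Fin d) ℝ) : ℝ := lamMinPos H / P.L

def step (H : Matrix (Fin m × Fin d) (Fin m × Fin d) ℝ) : ℝ := 1 / P.dualL H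

def momentum (H : Matrix (Fin m × Fin d) (Fin m × Fin d) ℝ) : ℝ :=
  (√(P.dualL H) - √(P.dualMu H)) / (√(P.dualL H) + √(P.dualMu H))

/-- The iterates `y^k` of Nesterov's fast gradient method applied to `Φ`. -/
def fastDual (γ : ℝ) (y₀ : Vec (DualIdx m d p)) (k : ℕ) : Vec (DualIdx m d p) :=
  (accel (∇ (P.Phi γ)) (P.step (P.gram γ)) (P.momentum (P.gram γ)) y₀ k).1

/-- The iterates `p^k` of the globally dual method
`q = p^k + β (p^k - p^{k-1})`, `p^{k+1} = q - η H x(q)`, where `x(q) = ∇F*(q)`. -/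
def globallyDual (H : Matrix (Fin m × Fin d) (Fin m × Fin d) ℝ)
    (p₀ : Vec (Fin m × Fin d)) (k : ℕ) : Vec (Fin m × Fin d) :=
  (accel (fun q => H.toEuclideanLin (dualOracle P.F q)) (P.step H) (P.momentum H) p₀ k).1

/-- `x` is `ε`-optimal and `ε`-feasible. -/
def EpsSolution (γ ε : ℝ) (x : Vec (Fin m × Fin d)) : Prop :=
  (∀ z, P.Feasible z → P.F x - P.F z ≤ ε) ∧ ‖(P.A γ).toEuclideanLin x‖ ≤ ε

/-- The problem-dependent factor `D` in the logarithm `log(D / ε)`, for the starting point `p₀`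
and the solution `xs`; it does not depend on `ε`. -/
def scale (γ : ℝ) (p₀ xs : Vec (Fin m × Fin d)) : ℝ :=
  let r := ‖p₀ - ∇ P.F xs‖ / P.μ
  3 + √(lamMax (P.gram γ)) * r + ‖∇ P.F xs‖ * r + P.L * r ^ 2

end Problem

/-! ### Chebyshev acceleration -/

/-- The rescaled Chebyshev polynomial of degree `K` for a spectrum in `{0} ∪ [lo, hi]`:
`1 - T_K((hi + lo - 2 X) / (hi - lo)) / T_K((hi + lo) / (hi - lo))`, and `X / hi` if `lo = hi`. -/
def chebPoly (lo hi : ℝ) (K : ℕ) : Polynomial ℝ :=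
  if lo = hi then Polynomial.C (1 / hi) * Polynomial.X
  else
    1 - Polynomial.C (1 / (Polynomial.Chebyshev.T ℝ (K : ℤ)).eval ((hi + lo) / (hi - lo))) *
      (Polynomial.Chebyshev.T ℝ (K : ℤ)).comp
        (Polynomial.C ((hi + lo) / (hi - lo)) - Polynomial.C (2 / (hi - lo)) * Polynomial.X)

/-- The Chebyshev polynomial used for the matrix `M`, of degree `⌈√χ(M)⌉`. -/
def chebFor {n : Type} [Fintype n] [DecidableEq n] (M : Matrix n n ℝ) : Polynomial ℝ :=
  chebPoly (lamMinPos M) (lamMax M) ⌈√(chi M)⌉₊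

/-- `P_K(M)`. -/
def chebMat {n : Type} [Fintype n] [DecidableEq n] (M : Matrix n n ℝ) : Matrix n n ℝ :=
  Polynomial.aeval M (chebFor M)

/-- `Aᵀ A = I ⊗ BᵀB + γ² W² ⊗ I` with `BᵀB` replaced by `P_M(BᵀB)`, `W` by `P_K(W)`, and `γ`
chosen by the same rule for the new matrices. -/
def Problem.chebGram {m d p : ℕ} (P : Problem m d p) :
    Matrix (Fin m × Fin d) (Fin m × Fin d) ℝ :=
  (1 : Matrix (Fin m) (Fin m) ℝ) ⊗ₖ chebMat P.BtB +
    (lamMinPos (chebMat P.BtB) / lamMinPos (chebMat P.W) ^ 2) •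
      ((chebMat P.W * chebMat P.W) ⊗ₖ (1 : Matrix (Fin d) (Fin d) ℝ))

/-! ### Cost model

Every node stores a linear subspace of `ℝ^d` and one of `ℝ^p` (linear combinations of vectors that
a node stores are free). A dual oracle step lets each node call its own dual oracle once, a
communication step lets each node send one stored vector of `ℝ^d` to all its neighbours, and a
multiplication step lets each node multiply one stored vector by `B` or by `Bᵀ`. -/

structure Memory (m d p : ℕ) where
  primal : Fin m → Submodule ℝ (Vec (Fin d))
  aux : Fin m → Submodule ℝ (Vec (Fin p))

/-- `Run P s₀ s a c b`: from the memory `s₀` the network can reach the memory `s` with `a` dual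
oracle calls at each node, `c` communications, and `b` multiplications by `B` or `Bᵀ` at each
node. -/
inductive Run {m d p : ℕ} (P : Problem m d p) (s₀ : Memory m d p) :
    Memory m d p → ℕ → ℕ → ℕ → Prop
  | init : Run P s₀ s₀ 0 0 0
  | oracle {s : Memory m d p} {a c b : ℕ} (h : Run P s₀ s a c b) (u : Fin m → Vec (Fin d))
      (hu : ∀ i, u i ∈ s.primal i) :
      Run P s₀ ⟨fun i => s.primal i ⊔ Submodule.span ℝ {dualOracle (P.f i) (u i)}, s.aux⟩
        (a + 1) c b
  | comm {s : Memory m d p} {a c b : ℕ} (h : Run P s₀ s a c b) (u : Fin m → Vec (Fin d))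
      (hu : ∀ i, u i ∈ s.primal i) :
      Run P s₀ ⟨fun i => s.primal i ⊔ Submodule.span ℝ (u '' {j | P.graph.Adj i j}), s.aux⟩
        a (c + 1) b
  | mulB {s : Memory m d p} {a c b : ℕ} (h : Run P s₀ s a c b) (u : Fin m → Vec (Fin d))
      (hu : ∀ i, u i ∈ s.primal i) :
      Run P s₀ ⟨s.primal, fun i => s.aux i ⊔ Submodule.span ℝ {P.B.toEuclideanLin (u i)}⟩
        a c (b + 1)
  | mulBT {s : Memory m d p} {a c b : ℕ} (h : Run P s₀ s a c b) (t : Fin m → Vec (Fin p))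
      (ht : ∀ i, t i ∈ s.aux i) :
      Run P s₀ ⟨fun i => s.primal i ⊔ Submodule.span ℝ {P.B.transpose.toEuclideanLin (t i)},
        s.aux⟩ a c (b + 1)

/-- The vector `x = col(x_1, …, x_m)` can be computed, node `i` holding `x_i`, from the memory `s₀`
at the cost `(a, c, b)`. -/
def Computes {m d p : ℕ} (P : Problem m d p) (s₀ : Memory m d p) (x : Vec (Fin m × Fin d))
    (a c b : ℕ) : Prop :=
  ∃ s, Run P s₀ s a c b ∧ ∀ i, block x i ∈ s.primal i

/-- Node `i` stores only the `i`-th block of `p₀`. -/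
def primalMemory {m d : ℕ} (p : ℕ) (p₀ : Vec (Fin m × Fin d)) : Memory m d p :=
  ⟨fun i => Submodule.span ℝ {block p₀ i}, fun _ => ⊥⟩

/-- Node `i` stores only the `i`-th blocks of the two components of `y₀ = (u₀, v₀)`. -/
def dualMemory {m d p : ℕ} (y₀ : Vec (Problem.DualIdx m d p)) : Memory m d p :=
  ⟨fun i => Submodule.span ℝ {WithLp.toLp 2 fun j => y₀ (Sum.inr (i, j))},
    fun i => Submodule.span ℝ {WithLp.toLp 2 fun j => y₀ (Sum.inl (i, j))}⟩

end GloballyDual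

end

open scoped Kronecker Gradient RealInnerProductSpace

noncomputable section

namespace GloballyDual

/-! ### Convex conjugates: curvature, gradients and the dual oracle -/

section Convex

variable {E : Type} [NormedAddCommGroup E] [InnerProductSpace ℝ E]

/-! The feasible set is `ker A`. Both methods are Nesterov's method on a dual function, and the
primal point is recovered through `dualOracle`. Since `F` is `μ`-strongly convex and `L`-smooth,
`F*` is `1/μ`-smooth and `1/L`-strongly convex (`conjugate_le_quadratic`, `quadratic_le_conjugate`).
So `Φ(y) = F*(Aᵀ y)` has curvature at most `λ_max(AᵀA)/μ` everywhere and at least `λ⁺_min(AᵀA)/L`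
along `range A`. All gradients of `Φ` lie in `range A`, so the iterates stay in `y₀ + range A`,
where the linear rate of the strongly convex case holds (`accel_rate`). That affine space contains a
dual optimum: optimality of `xs` makes `∇F(xs)` orthogonal to `ker A`, which puts it in `range Aᵀ =
range AᵀA`.

Applying `Aᵀ` to the iterates gives a recursion that involves only `H = AᵀA`. Conversely, every
positive semidefinite `H` factors as `GᵀG`, so the analysis covers every `H` whose kernel is the
feasible set, in particular the Chebyshev matrix (`globallyDual_gap`). By Fenchel duality and strong
convexity the dual gap bounds `μ/2 ‖x(q) - xs‖²`, and this distance controls both the suboptimality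
and the constraint residual (`epsSolution_of_gap`).

The condition numbers come from the eigenvalues `l i + c * t j ^ 2` of `I ⊗ M + c T² ⊗ I`. Because
`M` and `T` are both singular, the least nonzero one is the minimum of the two separate
contributions, and the optimal `γ` equalizes them. The polynomial of degree `⌈√χ⌉` sends the nonzero
spectrum into `[1/3, 5/3]` and fixes `0`, so the accelerated matrix has condition number at most `5
+ 5²`. The costs follow by tracking which block vectors the nodes hold and applying polynomials by
Horner's scheme. -/

theorem hasGradientAt_of_quadratic_bound [CompleteSpace E] {φ : E → ℝ} {g x : E} {c : ℝ}
    (h : ∀ y, |φ y - φ x - ⟪g, y - x⟫| ≤ c * ‖y - x‖ ^ 2) : HasGradientAt φ g x := by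
  rw [hasGradientAt_iff_isLittleO]
  refine Asymptotics.IsBigO.trans_isLittleO (g := fun y => ‖y - x‖ ^ 2) ?_
    (Asymptotics.isLittleO_pow_sub_sub x one_lt_two)
  refine Asymptotics.IsBigO.of_bound c (Filter.Eventually.of_forall fun y => ?_)
  simpa using h y

/-- A continuous function with quadratic growth attains its minimum on every subspace. -/
theorem exists_min_on_submodule [FiniteDimensional ℝ E] {φ : E → ℝ} (hφ : Continuous φ)
    {a : ℝ} (ha : 0 < a) {g : E} {c : ℝ} (hgrow : ∀ x, c + ⟪g, x⟫ + a * ‖x‖ ^ 2 ≤ φ x)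
    (V : Submodule ℝ E) : ∃ x ∈ V, ∀ y ∈ V, φ x ≤ φ y := by
  have key : Filter.Tendsto (fun x : V => φ x) (Filter.cocompact V) Filter.atTop := by
    have h1 : Filter.Tendsto (fun t : ℝ => c + t * (a * t - ‖g‖)) Filter.atTop Filter.atTop := by
      refine Filter.tendsto_atTop_add_const_left _ _ ?_
      refine Filter.Tendsto.atTop_mul_atTop₀ Filter.tendsto_id ?_
      exact Filter.tendsto_atTop_add_const_right _ (-‖g‖) (Filter.tendsto_id.const_mul_atTop ha)
    refine Filter.tendsto_atTop_mono (fun x => ?_) (h1.comp (tendsto_norm_cocompact_atTop (E := V)))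
    have h2 := hgrow x
    have h3 := (abs_le.1 (abs_real_inner_le_norm g (x : E))).1
    simp only [Function.comp, Submodule.coe_norm] at *
    nlinarith
  obtain ⟨x, hx⟩ := (hφ.comp continuous_subtype_val).exists_forall_le key
  exact ⟨x, x.2, fun y hy => hx ⟨y, hy⟩⟩

variable [CompleteSpace E] {f : E → ℝ} {μ L : ℝ}

theorem IsStronglyConvexOn.growth (hf : IsStronglyConvexOn Set.univ μ f) (q : E) :
    ∀ x, f 0 + ⟪∇ f 0 - q, x⟫ + μ / 2 * ‖x‖ ^ 2 ≤ f x - ⟪q, x⟫ := by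
  intro x
  have := hf.2 0 trivial x trivial
  simp only [sub_zero] at this
  rw [inner_sub_left]
  linarith

/-- Fermat's rule in one direction, the tangent inequality of a convex function in the other. It
makes `∇ f` and `dualOracle f` mutually inverse. -/
theorem isMaxOn_iff_gradient_eq (hμ : 0 < μ) (hf : IsStronglyConvexOn Set.univ μ f) (q z : E) :
    IsMaxOn (fun x => ⟪q, x⟫ - f x) Set.univ z ↔ ∇ f z = q := by
  constructor
  · intro h
    have h1 : IsLocalMax (fun x => ⟪q, x⟫ - f x) z := h.isLocalMax Filter.univ_mem
    have h2 : HasFDerivAt (fun x => ⟪q, x⟫ - f x) (innerSL ℝ q - fderiv ℝ f z) z :=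
      (innerSL ℝ q).hasFDerivAt.sub (hf.1 z).hasFDerivAt
    have h3 := h1.hasFDerivAt_eq_zero h2
    refine ext_inner_right ℝ fun v => ?_
    have h4 := congrArg (fun T : E →L[ℝ] ℝ => T v) h3
    simp only [sub_apply, innerSL_apply_apply, zero_apply] at h4
    rw [inner_gradient_left]
    linarith
  · rintro rfl x -
    have h := hf.2 z trivial x trivial
    rw [inner_sub_right] at h
    have : 0 ≤ μ / 2 * ‖x - z‖ ^ 2 := by positivity
    simp only [Set.mem_ofPred_eq]
    linarith

theorem exists_gradient_eq [FiniteDimensional ℝ E] (hμ : 0 < μ)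
    (hf : IsStronglyConvexOn Set.univ μ f) (q : E) : ∃ z, ∇ f z = q := by
  obtain ⟨z, -, hz⟩ := exists_min_on_submodule (φ := fun x => f x - ⟪q, x⟫)
    (hf.1.continuous.sub (continuous_const.inner continuous_id)) (half_pos hμ) (hf.growth q) ⊤
  refine ⟨z, (isMaxOn_iff_gradient_eq hμ hf q z).1 fun x _ => ?_⟩
  have := hz x trivial
  simp only [Set.mem_ofPred_eq]
  linarith

theorem conjugate_gradient (hμ : 0 < μ) (hf : IsStronglyConvexOn Set.univ μ f) (z : E) :
    conjugate f (∇ f z) = ⟪∇ f z, z⟫ - f z := by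
  have h := (isMaxOn_iff_gradient_eq hμ hf _ z).2 rfl
  refine IsGreatest.csSup_eq ⟨⟨z, rfl⟩, ?_⟩
  rintro _ ⟨x, rfl⟩
  exact h (Set.mem_univ x)

theorem le_conjugate [FiniteDimensional ℝ E] (hμ : 0 < μ)
    (hf : IsStronglyConvexOn Set.univ μ f) (q x : E) : ⟪q, x⟫ - f x ≤ conjugate f q := by
  obtain ⟨z, rfl⟩ := exists_gradient_eq hμ hf q
  rw [conjugate_gradient hμ hf]
  exact (isMaxOn_iff_gradient_eq hμ hf _ z).2 rfl (Set.mem_univ x)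

/-- Strong convexity dualizes to smoothness: writing `q = ∇ f x`, the term `⟪q - ∇ f z, x - z⟫ - μ/2
‖x - z‖²` left over is at most `‖q - ∇ f z‖² / (2μ)` by completing the square. -/
theorem conjugate_le_quadratic [FiniteDimensional ℝ E] (hμ : 0 < μ)
    (hf : IsStronglyConvexOn Set.univ μ f) (z q : E) :
    conjugate f q ≤ conjugate f (∇ f z) + ⟪z, q - ∇ f z⟫ + 1 / (2 * μ) * ‖q - ∇ f z‖ ^ 2 := by
  obtain ⟨x, rfl⟩ := exists_gradient_eq hμ hf q
  rw [conjugate_gradient hμ hf, conjugate_gradient hμ hf]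
  have h := hf.2 z trivial x trivial
  set g := ∇ f z
  set q := ∇ f x
  have h1 : 0 ≤ 1 / (2 * μ) * ‖(q - g) - μ • (x - z)‖ ^ 2 := by positivity
  rw [norm_sub_sq_real, norm_smul, inner_smul_right, Real.norm_of_nonneg hμ.le] at h1
  have h2 : 1 / (2 * μ) * (‖q - g‖ ^ 2 - 2 * (μ * ⟪q - g, x - z⟫) + (μ * ‖x - z‖) ^ 2)
      = 1 / (2 * μ) * ‖q - g‖ ^ 2 - ⟪q - g, x - z⟫ + μ / 2 * ‖x - z‖ ^ 2 := by
    field_simp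
  rw [h2] at h1
  simp only [inner_sub_left, inner_sub_right] at *
  rw [real_inner_comm q z, real_inner_comm g z]
  linarith

/-- Smoothness dualizes to strong convexity: the supremum is tested at the maximizer `z + L⁻¹ (q - ∇
f z)` of the quadratic minorant of `⟪q, ·⟫ - f` that smoothness gives. -/
theorem quadratic_le_conjugate [FiniteDimensional ℝ E] (hμ : 0 < μ)
    (hf : IsStronglyConvexOn Set.univ μ f) (hL : 0 < L) (hs : IsSmooth L f) (z q : E) :
    conjugate f (∇ f z) + ⟪z, q - ∇ f z⟫ + 1 / (2 * L) * ‖q - ∇ f z‖ ^ 2 ≤ conjugate f q := by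
  have h := le_conjugate hμ hf q (z + L⁻¹ • (q - ∇ f z))
  have h1 := hs.2 z (z + L⁻¹ • (q - ∇ f z))
  rw [conjugate_gradient hμ hf]
  set g := ∇ f z
  rw [add_sub_cancel_left, norm_smul, inner_smul_right, Real.norm_of_nonneg (by positivity)] at h1
  rw [inner_add_right, inner_smul_right] at h
  have h2 : L⁻¹ * ⟪q, q - g⟫ - L⁻¹ * ⟪g, q - g⟫ = L⁻¹ * ‖q - g‖ ^ 2 := by
    rw [← mul_sub, ← inner_sub_left, real_inner_self_eq_norm_sq]
  have h3 : L / 2 * (L⁻¹ * ‖q - g‖) ^ 2 = L⁻¹ * ‖q - g‖ ^ 2 - 1 / (2 * L) * ‖q - g‖ ^ 2 := by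
    field_simp
    ring
  rw [inner_sub_right z, real_inner_comm q z, real_inner_comm g z]
  linarith

theorem tangent_le_conjugate [FiniteDimensional ℝ E] (hμ : 0 < μ)
    (hf : IsStronglyConvexOn Set.univ μ f) (z q : E) :
    conjugate f (∇ f z) + ⟪z, q - ∇ f z⟫ ≤ conjugate f q := by
  have h := le_conjugate hμ hf q z
  rw [conjugate_gradient hμ hf, inner_sub_right z, real_inner_comm q z,
    real_inner_comm (∇ f z) z]
  linarith

theorem hasGradientAt_conjugate [FiniteDimensional ℝ E] (hμ : 0 < μ)
    (hf : IsStronglyConvexOn Set.univ μ f) (z : E) :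
    HasGradientAt (conjugate f) z (∇ f z) := by
  refine hasGradientAt_of_quadratic_bound (c := 1 / (2 * μ)) fun q => ?_
  have h1 := conjugate_le_quadratic hμ hf z q
  have h2 := tangent_le_conjugate hμ hf z q
  rw [abs_le]
  have : 0 ≤ 1 / (2 * μ) * ‖q - ∇ f z‖ ^ 2 := by positivity
  constructor <;> linarith

theorem dualOracle_gradient [FiniteDimensional ℝ E] (hμ : 0 < μ)
    (hf : IsStronglyConvexOn Set.univ μ f) (z : E) : dualOracle f (∇ f z) = z :=
  (hasGradientAt_conjugate hμ hf z).gradient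

theorem gradient_dualOracle [FiniteDimensional ℝ E] (hμ : 0 < μ)
    (hf : IsStronglyConvexOn Set.univ μ f) (q : E) : ∇ f (dualOracle f q) = q := by
  obtain ⟨z, rfl⟩ := exists_gradient_eq hμ hf q
  rw [dualOracle_gradient hμ hf]

/-- The dual gap controls the distance of the dual oracle from any point, in Fenchel form. -/
theorem norm_dualOracle_sub_sq_le [FiniteDimensional ℝ E] (hμ : 0 < μ)
    (hf : IsStronglyConvexOn Set.univ μ f) (q z : E) :
    μ / 2 * ‖dualOracle f q - z‖ ^ 2 ≤ conjugate f q - (⟪q, z⟫ - f z) := by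
  obtain ⟨x, rfl⟩ := exists_gradient_eq hμ hf q
  rw [dualOracle_gradient hμ hf, conjugate_gradient hμ hf, norm_sub_rev]
  have h := hf.2 x trivial z trivial
  rw [inner_sub_right] at h
  linarith

/-- Both bounds are compared at one nonzero displacement; in the zero space the constants would be
unrelated. -/
theorem le_of_stronglyConvex_of_smooth [Nontrivial E]
    (hf : IsStronglyConvexOn Set.univ μ f) (hs : IsSmooth L f) : μ ≤ L := by
  obtain ⟨x, hx⟩ := exists_ne (0 : E)
  have h1 := hf.2 0 trivial x trivial
  have h2 := hs.2 0 x
  have h3 : 0 < ‖x - 0‖ ^ 2 := by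
    rw [sub_zero]
    positivity
  nlinarith

end Convex

/-! ### Nesterov's method -/

section Accel

variable {E : Type} [NormedAddCommGroup E] [InnerProductSpace ℝ E]

theorem accel_succ_fst (g : E → E) (η β : ℝ) (y₀ : E) (k : ℕ) :
    (accel g η β y₀ (k + 1)).1 =
      (accel g η β y₀ k).1 + β • ((accel g η β y₀ k).1 - (accel g η β y₀ k).2) -
        η • g ((accel g η β y₀ k).1 + β • ((accel g η β y₀ k).1 - (accel g η β y₀ k).2)) := rfl

/-- One step of the Lyapunov analysis; `s² = κ / ℓ`. -/
theorem lyapunov_step {φ : E → ℝ} {g z y w ys : E} {ℓ s : ℝ} (hℓ : 0 < ℓ) (hs : 0 < s)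
    (hs1 : s ≤ 1) (hz : (1 + s) • z = y + s • w)
    (hup : φ (z - (1 / ℓ) • g) ≤ φ z - 1 / (2 * ℓ) * ‖g‖ ^ 2)
    (hy : φ z + ⟪g, y - z⟫ ≤ φ y)
    (hys : φ z + ⟪g, ys - z⟫ + s ^ 2 * ℓ / 2 * ‖ys - z‖ ^ 2 ≤ φ ys) :
    φ (z - (1 / ℓ) • g) - φ ys +
        s ^ 2 * ℓ / 2 * ‖(1 - s) • w + s • z - (1 / (s * ℓ)) • g - ys‖ ^ 2 ≤
      (1 - s) * (φ y - φ ys + s ^ 2 * ℓ / 2 * ‖w - ys‖ ^ 2) := by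
  have e1 : (1 - s) • w + s • z - (1 / (s * ℓ)) • g - ys =
      ((1 - s) • (w - ys) + s • (z - ys)) - (1 / (s * ℓ)) • g := by module
  have e2 : ‖(1 - s) • (w - ys) + s • (z - ys)‖ ^ 2 ≤
      (1 - s) * ‖w - ys‖ ^ 2 + s * ‖ys - z‖ ^ 2 := by
    have : ‖(1 - s) • (w - ys) + s • (z - ys)‖ ^ 2 =
        (1 - s) * ‖w - ys‖ ^ 2 + s * ‖ys - z‖ ^ 2 - s * (1 - s) * ‖(w - ys) - (z - ys)‖ ^ 2 := by
      rw [norm_add_sq_real, norm_sub_sq_real (w - ys), norm_smul, norm_smul, inner_smul_left,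
        inner_smul_right, mul_pow, mul_pow, norm_sub_rev ys z]
      simp only [Real.norm_eq_abs, sq_abs, conj_trivial]
      ring
    rw [this]
    have : 0 ≤ s * (1 - s) * ‖(w - ys) - (z - ys)‖ ^ 2 := by
      have := sub_nonneg.2 hs1
      positivity
    linarith
  -- The last term of this expansion is exactly the decrease that `hup` provides.
  have e3 : s ^ 2 * ℓ / 2 * ‖((1 - s) • (w - ys) + s • (z - ys)) - (1 / (s * ℓ)) • g‖ ^ 2 =
      s ^ 2 * ℓ / 2 * ‖(1 - s) • (w - ys) + s • (z - ys)‖ ^ 2 -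
        s * ⟪g, (1 - s) • (w - ys) + s • (z - ys)⟫ + 1 / (2 * ℓ) * ‖g‖ ^ 2 := by
    rw [norm_sub_sq_real, norm_smul, inner_smul_right, mul_pow, Real.norm_eq_abs, sq_abs,
      real_inner_comm g]
    field_simp
  -- The tangent inequalities at `y` and `ys`, weighted by `1 - s` and `s`, produce inner products
  -- with `g` that cancel those of `e3`; the coupling `hz` of `z`, `y`, `w` is designed for this.
  have e4 : s * ⟪g, (1 - s) • (w - ys) + s • (z - ys)⟫ +
      ((1 - s) * ⟪g, y - z⟫ + s * ⟪g, ys - z⟫) = 0 := by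
    have : y = (1 + s) • z - s • w := by rw [hz]; module
    subst this
    simp only [inner_add_right, inner_sub_right, inner_smul_right]
    ring
  have e5 := mul_le_mul_of_nonneg_left e2 (by positivity : 0 ≤ s ^ 2 * ℓ / 2)
  have e6 := mul_le_mul_of_nonneg_left hy (sub_nonneg.2 hs1)
  have e7 := mul_le_mul_of_nonneg_left hys hs.le
  rw [e1, e3]
  linarith

/-- The linear rate of Nesterov's method for a function that is strongly convex along a subspace
containing all its gradients. -/
theorem accel_rate {φ : E → ℝ} {g : E → E} {ℓ κ : ℝ} (hκ : 0 < κ) (hκℓ : κ ≤ ℓ)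
    (V : Submodule ℝ E) (hgV : ∀ x, g x ∈ V)
    (hup : ∀ x y, φ y ≤ φ x + ⟪g x, y - x⟫ + ℓ / 2 * ‖y - x‖ ^ 2)
    (hlow : ∀ x y, y - x ∈ V → φ x + ⟪g x, y - x⟫ + κ / 2 * ‖y - x‖ ^ 2 ≤ φ y)
    (y₀ ys : E) (hys : ys - y₀ ∈ V) (k : ℕ) :
    φ (accel g (1 / ℓ) ((√ℓ - √κ) / (√ℓ + √κ)) y₀ k).1 - φ ys ≤
      (1 - √(κ / ℓ)) ^ k * (φ y₀ - φ ys + κ / 2 * ‖y₀ - ys‖ ^ 2) := by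
  have hℓ : 0 < ℓ := hκ.trans_le hκℓ
  set s := √(κ / ℓ) with hsdef
  have hs : 0 < s := Real.sqrt_pos.2 (div_pos hκ hℓ)
  have hs1 : s ≤ 1 := Real.sqrt_le_one.2 ((div_le_one hℓ).2 hκℓ)
  have hsκ : s ^ 2 * ℓ = κ := by
    rw [hsdef, Real.sq_sqrt (div_pos hκ hℓ).le, div_mul_cancel₀ _ hℓ.ne']
  have hβ : (√ℓ - √κ) / (√ℓ + √κ) = (1 - s) / (1 + s) := by
    have h1 := Real.sqrt_pos.2 hℓ
    have h2 := Real.sqrt_pos.2 hκ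
    rw [hsdef, Real.sqrt_div hκ.le]
    field_simp
  rw [hβ]
  set a := accel g (1 / ℓ) ((1 - s) / (1 + s)) y₀ with ha
  -- The iterates stay in `y₀ + V`, the only region where the lower bound `hlow` can be used between
  -- them and `ys`.
  have hmem : ∀ k, (a k).1 - y₀ ∈ V ∧ (a k).2 - y₀ ∈ V := by
    intro k
    induction k with
    | zero => simp [ha, accel]
    | succ k ih =>
      refine ⟨?_, ih.1⟩
      rw [ha, accel_succ_fst, ← ha]
      have : (a k).1 + ((1 - s) / (1 + s)) • ((a k).1 - (a k).2) - (1 / ℓ) •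
          g ((a k).1 + ((1 - s) / (1 + s)) • ((a k).1 - (a k).2)) - y₀ =
        ((a k).1 - y₀) + ((1 - s) / (1 + s)) • (((a k).1 - y₀) - ((a k).2 - y₀)) - (1 / ℓ) •
          g ((a k).1 + ((1 - s) / (1 + s)) • ((a k).1 - (a k).2)) := by module
      rw [this]
      exact V.sub_mem (V.add_mem ih.1 (V.smul_mem _ (V.sub_mem ih.1 ih.2)))
        (V.smul_mem _ (hgV _))
  -- The auxiliary point of the Lyapunov function is the extrapolation `y^{k-1} + (1/s)(y^k -
  -- y^{k-1})`, expressed by the iterates alone. At `k = 0` it is `y₀`, because `y^{-1} = y^0`.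
  have key : ∀ k, φ (a k).1 - φ ys + κ / 2 * ‖(a k).2 + (1 / s) • ((a k).1 - (a k).2) - ys‖ ^ 2 ≤
      (1 - s) ^ k * (φ y₀ - φ ys + κ / 2 * ‖y₀ - ys‖ ^ 2) := by
    intro k
    induction k with
    | zero => simp [ha, accel]
    | succ k ih =>
      obtain ⟨m1, m2⟩ := hmem k
      set y := (a k).1
      set y' := (a k).2
      set z := y + ((1 - s) / (1 + s)) • (y - y') with hzdef
      have hyz : y - z ∈ V := by
        have : y - z = -(((1 - s) / (1 + s)) • ((y - y₀) - (y' - y₀))) := by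
          rw [hzdef]; module
        rw [this]
        exact V.neg_mem (V.smul_mem _ (V.sub_mem m1 m2))
      have hysz : ys - z ∈ V := by
        have : ys - z = (ys - y₀) - (y - y₀) + (y - z) := by module
        rw [this]
        exact V.add_mem (V.sub_mem hys m1) hyz
      have h1 : (a (k + 1)).1 = z - (1 / ℓ) • g z := rfl
      have h2 : (a (k + 1)).2 = y := rfl
      set w := y' + (1 / s) • (y - y') with hw
      have hz : (1 + s) • z = y + s • w := by
        rw [hzdef, hw]
        match_scalars <;> field_simp <;> ring
      -- The next extrapolated point coincides with the one that `lyapunov_step` controls.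
      have h3 : y + (1 / s) • (z - (1 / ℓ) • g z - y) =
          (1 - s) • w + s • z - (1 / (s * ℓ)) • g z := by
        have e' : s • w = (1 + s) • z - y := by rw [hz]; module
        have e'' : w = (1 / s) • ((1 + s) • z - y) := by
          rw [← e', smul_smul, one_div_mul_cancel hs.ne', one_smul]
        rw [e'']
        match_scalars <;> field_simp <;> ring
      have hstep := lyapunov_step (φ := φ) (g := g z) (ys := ys) hℓ hs hs1 hz
        (by
          have := hup z (z - (1 / ℓ) • g z)
          rw [sub_sub_cancel_left, inner_neg_right, norm_neg, inner_smul_right, norm_smul, mul_pow,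
            Real.norm_eq_abs, sq_abs, real_inner_self_eq_norm_sq] at this
          refine this.trans (le_of_eq ?_)
          field_simp
          ring)
        (by
          have := hlow z y hyz
          have h0 : 0 ≤ κ / 2 * ‖y - z‖ ^ 2 := by positivity
          linarith)
        (by rw [hsκ]; exact hlow z ys hysz)
      rw [hsκ] at hstep
      rw [h1, h2, h3, pow_succ' (1 - s), mul_assoc]
      exact hstep.trans (mul_le_mul_of_nonneg_left ih (sub_nonneg.2 hs1))
  have h0 : 0 ≤ κ / 2 * ‖(a k).2 + (1 / s) • ((a k).1 - (a k).2) - ys‖ ^ 2 := by positivity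
  linarith [key k]

end Accel

/-! ### Orthogonal diagonalization: extreme eigenvalues, polynomials, Kronecker sums -/

section Spectral

variable {n : Type} [Fintype n] [DecidableEq n]

/-- `M = U diag(l) Uᵀ` with `U` orthogonal. -/
structure OrthoDiag (M U : Matrix n n ℝ) (l : n → ℝ) : Prop where
  orth : U.transpose * U = 1
  eq : M = U * Matrix.diagonal l * U.transpose

namespace OrthoDiag

variable {M U : Matrix n n ℝ} {l : n → ℝ}

theorem orth' (h : OrthoDiag M U l) : U * U.transpose = 1 := mul_eq_one_comm.1 h.orth

theorem spectrum_eq (h : OrthoDiag M U l) : spectrum ℝ M = Set.range l := by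
  let u : (Matrix n n ℝ)ˣ := ⟨U, U.transpose, h.orth', h.orth⟩
  have : M = u * Matrix.diagonal l * (u⁻¹ : (Matrix n n ℝ)ˣ) := h.eq
  rw [this, spectrum.units_conjugate, spectrum_diagonal]

theorem transpose_mulVec (h : OrthoDiag M U l) (x : n → ℝ) (i : n) :
    U.transpose.mulVec (M.mulVec x) i = l i * U.transpose.mulVec x i := by
  rw [Matrix.mulVec_mulVec]
  conv_lhs => rw [h.eq, ← mul_assoc, ← mul_assoc, h.orth, one_mul, ← Matrix.mulVec_mulVec,
    Matrix.mulVec_diagonal]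

theorem dotProduct_transpose (h : OrthoDiag M U l) (x y : n → ℝ) :
    dotProduct x y = ∑ i, U.transpose.mulVec x i * U.transpose.mulVec y i := by
  change _ = dotProduct (U.transpose.mulVec x) (U.transpose.mulVec y)
  rw [Matrix.dotProduct_mulVec, Matrix.vecMul_transpose, Matrix.mulVec_mulVec, h.orth',
    Matrix.one_mulVec]

theorem mulVec_eq_zero_iff (h : OrthoDiag M U l) (x : n → ℝ) :
    M.mulVec x = 0 ↔ ∀ i, l i = 0 ∨ U.transpose.mulVec x i = 0 := by
  constructor
  · intro hx i
    have := h.transpose_mulVec x i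
    rw [hx, Matrix.mulVec_zero] at this
    simpa using this.symm
  · intro hx
    have h1 : U.transpose.mulVec (M.mulVec x) = 0 := by
      ext i
      rw [h.transpose_mulVec]
      simpa using hx i
    have h2 := congrArg (fun v => U.mulVec v) h1
    simpa [Matrix.mulVec_mulVec, ← mul_assoc, h.orth'] using h2

theorem exists_of_isHermitian (hM : M.IsHermitian) : ∃ U l, OrthoDiag M U l := by
  refine ⟨hM.eigenvectorUnitary, hM.eigenvalues, ?_, ?_⟩
  · have := Unitary.coe_star_mul_self hM.eigenvectorUnitary
    simpa [Matrix.star_eq_conjTranspose] using this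
  · have := hM.spectral_theorem
    simpa [Matrix.star_eq_conjTranspose, Unitary.conjStarAlgAut_apply, Function.comp_def] using this

theorem aeval (h : OrthoDiag M U l) (q : Polynomial ℝ) :
    OrthoDiag (Polynomial.aeval M q) U (fun i => q.eval (l i)) := by
  refine ⟨h.orth, ?_⟩
  induction q using Polynomial.induction_on' with
  | add p q hp hq =>
    simp only [map_add, Polynomial.eval_add]
    rw [hp, hq, ← Matrix.diagonal_add, mul_add, add_mul]
  | monomial k a =>
    have hk : ∀ k : ℕ, M ^ k = U * Matrix.diagonal (fun i => l i ^ k) * U.transpose := by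
      intro k
      induction k with
      | zero => simp [h.orth']
      | succ k ih =>
        rw [pow_succ, ih]
        conv_lhs => rw [h.eq]
        have : U * Matrix.diagonal (fun i => l i ^ k) * U.transpose *
            (U * Matrix.diagonal l * U.transpose) =
            U * (Matrix.diagonal (fun i => l i ^ k) * (U.transpose * U) * Matrix.diagonal l) *
              U.transpose := by simp only [mul_assoc]
        rw [this, h.orth, mul_one, Matrix.diagonal_mul_diagonal]
        simp only [pow_succ]
    rw [Polynomial.aeval_monomial, hk, ← Algebra.smul_def]
    simp only [Polynomial.eval_monomial]
    rw [← smul_mul_assoc, ← mul_smul_comm, ← Matrix.diagonal_smul]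
    rfl

/-- `V ⊗ U` diagonalizes both summands simultaneously; `T * T` is handled as the polynomial `X ^ 2`
in `T`. -/
theorem kronecker {n' : Type} [Fintype n'] [DecidableEq n'] {T V : Matrix n' n' ℝ} {t : n' → ℝ}
    (h : OrthoDiag M U l) (h' : OrthoDiag T V t) (c : ℝ) :
    OrthoDiag ((1 : Matrix n' n' ℝ) ⊗ₖ M + c • ((T * T) ⊗ₖ (1 : Matrix n n ℝ))) (V ⊗ₖ U)
      (fun i => l i.2 + c * t i.1 ^ 2) := by
  have htr : (V ⊗ₖ U).transpose = V.transpose ⊗ₖ U.transpose :=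
    (Matrix.kroneckerMap_transpose _ _ _).symm
  refine ⟨?_, ?_⟩
  · rw [htr, ← Matrix.mul_kronecker_mul, h.orth, h'.orth, Matrix.one_kronecker_one]
  · have e1 : T * T = V * Matrix.diagonal (fun i => t i ^ 2) * V.transpose := by
      have := (h'.aeval (Polynomial.X ^ 2)).eq
      simpa [pow_two] using this
    have e2 : (Matrix.diagonal (fun i : n' × n => l i.2 + c * t i.1 ^ 2)) =
        (1 : Matrix n' n' ℝ) ⊗ₖ Matrix.diagonal l +
          c • (Matrix.diagonal (fun i => t i ^ 2) ⊗ₖ (1 : Matrix n n ℝ)) := by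
      rw [← Matrix.diagonal_one, ← Matrix.diagonal_one, Matrix.diagonal_kronecker_diagonal,
        Matrix.diagonal_kronecker_diagonal, ← Matrix.diagonal_smul, Matrix.diagonal_add]
      simp
    rw [e2, htr, mul_add, add_mul, mul_smul_comm, smul_mul_assoc, ← Matrix.mul_kronecker_mul,
      ← Matrix.mul_kronecker_mul, ← Matrix.mul_kronecker_mul, ← Matrix.mul_kronecker_mul, ← e1,
      ← h.eq, mul_one, mul_one, h.orth', h'.orth']

end OrthoDiag

/-- An orthogonal diagonalization with nonnegative eigenvalues, at least one of them zero and at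
least one nonzero. -/
structure SingDiag (M U : Matrix n n ℝ) (l : n → ℝ) : Prop extends OrthoDiag M U l where
  nonneg : ∀ i, 0 ≤ l i
  exists_zero : ∃ i, l i = 0
  exists_ne : ∃ i, l i ≠ 0

namespace SingDiag

variable {M U : Matrix n n ℝ} {l : n → ℝ}

theorem exists_of_posSemidef (hM : M.PosSemidef) (hne : M ≠ 0)
    (hker : ∃ x : n → ℝ, x ≠ 0 ∧ M.mulVec x = 0) : ∃ U l, SingDiag M U l := by
  obtain ⟨U, l, h⟩ := OrthoDiag.exists_of_isHermitian hM.1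
  refine ⟨U, l, h, fun i => ?_, ?_, ?_⟩
  · have hs : spectrum ℝ M ⊆ {a | 0 ≤ a} := by
      have := (Matrix.posSemidef_iff_isHermitian_and_spectrum_nonneg (𝕜 := ℝ) (A := M)).1 hM
      exact this.2
    exact hs (h.spectrum_eq ▸ ⟨i, rfl⟩)
  · obtain ⟨x, hx, hx0⟩ := hker
    by_contra! hl
    apply hx
    have h1 : U.transpose.mulVec x = 0 := by
      ext i
      exact ((h.mulVec_eq_zero_iff x).1 hx0 i).resolve_left (hl i)
    have h2 := congrArg (fun v => U.mulVec v) h1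
    simpa [Matrix.mulVec_mulVec, h.orth'] using h2
  · by_contra! hl
    apply hne
    rw [h.eq, show l = 0 from funext hl]
    simp

theorem lamMax_isGreatest (h : SingDiag M U l) : IsGreatest (Set.range l) (lamMax M) := by
  obtain ⟨i, -⟩ := h.exists_zero
  rw [lamMax, h.spectrum_eq]
  exact (Set.finite_range l).isClosed.isGreatest_csSup ⟨_, i, rfl⟩ (Set.finite_range l).bddAbove

theorem lamMinPos_isLeast (h : SingDiag M U l) :
    IsLeast {x | x ∈ Set.range l ∧ x ≠ 0} (lamMinPos M) := by
  obtain ⟨i, hi⟩ := h.exists_ne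
  rw [lamMinPos, h.spectrum_eq]
  have hfin : {x | x ∈ Set.range l ∧ x ≠ 0}.Finite := (Set.finite_range l).subset fun x hx => hx.1
  exact hfin.isClosed.isLeast_csInf ⟨_, ⟨i, rfl⟩, hi⟩ hfin.bddBelow

theorem le_lamMax (h : SingDiag M U l) (i : n) : l i ≤ lamMax M := h.lamMax_isGreatest.2 ⟨i, rfl⟩

theorem lamMinPos_le (h : SingDiag M U l) {i : n} (hi : l i ≠ 0) : lamMinPos M ≤ l i :=
  h.lamMinPos_isLeast.2 ⟨⟨i, rfl⟩, hi⟩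

theorem lamMinPos_pos (h : SingDiag M U l) : 0 < lamMinPos M := by
  obtain ⟨⟨i, hi⟩, hne⟩ := h.lamMinPos_isLeast.1
  exact lt_of_le_of_ne (hi ▸ h.nonneg i) hne.symm

theorem lamMinPos_le_lamMax (h : SingDiag M U l) : lamMinPos M ≤ lamMax M := by
  obtain ⟨⟨i, hi⟩, -⟩ := h.lamMinPos_isLeast.1
  exact hi ▸ h.le_lamMax i

theorem lamMax_pos (h : SingDiag M U l) : 0 < lamMax M :=
  h.lamMinPos_pos.trans_le h.lamMinPos_le_lamMax

theorem one_le_chi (h : SingDiag M U l) : 1 ≤ chi M :=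
  (one_le_div h.lamMinPos_pos).2 h.lamMinPos_le_lamMax

theorem inner_mulVec_le (h : SingDiag M U l) (x : n → ℝ) :
    dotProduct x (M.mulVec x) ≤ lamMax M * dotProduct x x := by
  rw [h.dotProduct_transpose, h.dotProduct_transpose, Finset.mul_sum]
  refine Finset.sum_le_sum fun i _ => ?_
  rw [h.transpose_mulVec]
  nlinarith [h.le_lamMax i, mul_self_nonneg (U.transpose.mulVec x i)]

/-- In eigencoordinates this is `λ⁺_min l ≤ l²` for every eigenvalue `l`, where zero eigenvalues are
harmless. For `M = GᵀG` it bounds `‖Gᵀ y‖` from below on `range G`. -/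
theorem inner_mulVec_le_mulVec (h : SingDiag M U l) (x : n → ℝ) :
    lamMinPos M * dotProduct x (M.mulVec x) ≤ dotProduct (M.mulVec x) (M.mulVec x) := by
  rw [h.dotProduct_transpose, h.dotProduct_transpose, Finset.mul_sum]
  refine Finset.sum_le_sum fun i _ => ?_
  rw [h.transpose_mulVec]
  by_cases hi : l i = 0
  · simp [hi]
  · have h1 := mul_nonneg (h.nonneg i) (mul_self_nonneg (U.transpose.mulVec x i))
    nlinarith [mul_le_mul_of_nonneg_right (h.lamMinPos_le hi) h1]

section Kronecker

variable {n' : Type} [Fintype n'] [DecidableEq n'] {T V : Matrix n' n' ℝ} {t : n' → ℝ}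

theorem kronecker (h : SingDiag M U l) (h' : SingDiag T V t) {c : ℝ} (hc : 0 < c) :
    SingDiag ((1 : Matrix n' n' ℝ) ⊗ₖ M + c • ((T * T) ⊗ₖ (1 : Matrix n n ℝ))) (V ⊗ₖ U)
      (fun i => l i.2 + c * t i.1 ^ 2) := by
  obtain ⟨i, hi⟩ := h.exists_zero
  obtain ⟨j, hj⟩ := h'.exists_zero
  obtain ⟨k, hk⟩ := h.exists_ne
  exact ⟨h.toOrthoDiag.kronecker h'.toOrthoDiag c,
    fun i => add_nonneg (h.nonneg _) (by positivity),
    ⟨(j, i), by simp [hi, hj]⟩, ⟨(j, k), by simpa [hj] using hk⟩⟩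

theorem lamMax_kronecker (h : SingDiag M U l) (h' : SingDiag T V t) {c : ℝ} (hc : 0 < c) :
    lamMax ((1 : Matrix n' n' ℝ) ⊗ₖ M + c • ((T * T) ⊗ₖ (1 : Matrix n n ℝ))) =
      lamMax M + c * lamMax T ^ 2 := by
  refine (h.kronecker h' hc).lamMax_isGreatest.unique ⟨?_, ?_⟩
  · obtain ⟨i, hi⟩ := h.lamMax_isGreatest.1
    obtain ⟨j, hj⟩ := h'.lamMax_isGreatest.1
    exact ⟨(j, i), by simp [hi, hj]⟩
  · rintro _ ⟨⟨j, i⟩, rfl⟩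
    have h1 := h.le_lamMax i
    have h2 := pow_le_pow_left₀ (h'.nonneg j) (h'.le_lamMax j) 2
    simp only
    gcongr

/-- Singularity of both matrices is essential: each term of the minimum is attained by pairing a
least nonzero eigenvalue of one matrix with a zero eigenvalue of the other. -/
theorem lamMinPos_kronecker (h : SingDiag M U l) (h' : SingDiag T V t) {c : ℝ} (hc : 0 < c) :
    lamMinPos ((1 : Matrix n' n' ℝ) ⊗ₖ M + c • ((T * T) ⊗ₖ (1 : Matrix n n ℝ))) =
      min (lamMinPos M) (c * lamMinPos T ^ 2) := by
  refine (h.kronecker h' hc).lamMinPos_isLeast.unique ⟨⟨?_, ?_⟩, ?_⟩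
  · obtain ⟨⟨i, hi⟩, -⟩ := h.lamMinPos_isLeast.1
    obtain ⟨⟨j, hj⟩, -⟩ := h'.lamMinPos_isLeast.1
    obtain ⟨i0, hi0⟩ := h.exists_zero
    obtain ⟨j0, hj0⟩ := h'.exists_zero
    rcases min_choice (lamMinPos M) (c * lamMinPos T ^ 2) with e | e
    · exact ⟨(j0, i), by simp [hi, hj0, e]⟩
    · exact ⟨(j, i0), by simp [hi0, hj, e]⟩
  · have h1 := h.lamMinPos_pos
    have h2 := h'.lamMinPos_pos
    exact (lt_min h1 (by positivity)).ne'
  · rintro _ ⟨⟨⟨j, i⟩, rfl⟩, hne⟩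
    simp only at hne ⊢
    by_cases hi : l i = 0
    · have hj : t j ≠ 0 := by
        rintro hj
        simp [hi, hj] at hne
      have h2 := pow_le_pow_left₀ h'.lamMinPos_pos.le (h'.lamMinPos_le hj) 2
      rw [hi, zero_add]
      exact (min_le_right _ _).trans (by gcongr)
    · have h1 := h.lamMinPos_le hi
      have h3 : 0 ≤ c * t j ^ 2 := by positivity
      exact (min_le_left _ _).trans (by linarith)

/-- The strict inequality is what makes the momentum positive even when `μ = L`. -/
theorem lamMinPos_lt_lamMax_kronecker (h : SingDiag M U l) (h' : SingDiag T V t) {c : ℝ}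
    (hc : 0 < c) :
    lamMinPos ((1 : Matrix n' n' ℝ) ⊗ₖ M + c • ((T * T) ⊗ₖ (1 : Matrix n n ℝ))) <
      lamMax ((1 : Matrix n' n' ℝ) ⊗ₖ M + c • ((T * T) ⊗ₖ (1 : Matrix n n ℝ))) := by
  rw [h.lamMax_kronecker h' hc, h.lamMinPos_kronecker h' hc]
  have h1 := h'.lamMax_pos
  have h2 : 0 < c * lamMax T ^ 2 := by positivity
  exact (min_le_left _ _).trans_lt (by linarith [h.lamMinPos_le_lamMax])

/-- With the weight that equalizes the two minimal eigenvalues. -/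
theorem chi_kronecker_balanced (h : SingDiag M U l) (h' : SingDiag T V t) {c : ℝ}
    (hc : c = lamMinPos M / lamMinPos T ^ 2) :
    chi ((1 : Matrix n' n' ℝ) ⊗ₖ M + c • ((T * T) ⊗ₖ (1 : Matrix n n ℝ))) =
      chi M + chi T ^ 2 := by
  have h1 := h.lamMinPos_pos
  have h2 := h'.lamMinPos_pos
  have hc0 : 0 < c := by rw [hc]; positivity
  rw [chi, h.lamMax_kronecker h' hc0, h.lamMinPos_kronecker h' hc0, chi, chi]
  have : c * lamMinPos T ^ 2 = lamMinPos M := by rw [hc]; field_simp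
  rw [this, min_self, hc]
  field_simp

end Kronecker

end SingDiag

end Spectral

/-! ### Chebyshev polynomials as spectral preconditioners -/

section Chebyshev

open Polynomial

variable {lo hi : ℝ} {K : ℕ}

/-- With `x = √(hi/lo)` and `ρ = (x+1)/(x-1)` the point is `cosh (log ρ)`, so the value is `(ρ^K +
ρ^{-K})/2`. Bernoulli gives `ρ^K ≥ 1 + 2K/(x-1) ≥ 3` once `K ≥ x`. -/
theorem three_halves_le_eval_T (hlo : 0 < lo) (hlt : lo < hi) (hK : √(hi / lo) ≤ K) :
    3 / 2 ≤ (Chebyshev.T ℝ (K : ℤ)).eval ((hi + lo) / (hi - lo)) := by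
  set x := √(hi / lo) with hx
  have hx2 : x ^ 2 = hi / lo := Real.sq_sqrt (div_pos (hlo.trans hlt) hlo).le
  have hx1 : 1 < x := by
    rw [hx, Real.lt_sqrt zero_le_one]
    rw [one_pow, one_lt_div hlo]
    exact hlt
  have hhi : hi = x ^ 2 * lo := by rw [hx2, div_mul_cancel₀ _ hlo.ne']
  have hx0 : 0 < x - 1 := sub_pos.2 hx1
  have hρ : 0 < (x + 1) / (x - 1) := by positivity
  have e1 : (hi + lo) / (hi - lo) = Real.cosh (Real.log ((x + 1) / (x - 1))) := by
    have h1 : x ^ 2 * lo - lo = lo * ((x - 1) * (x + 1)) := by ring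
    rw [Real.cosh_log hρ, hhi, h1]
    have : x + 1 ≠ 0 := by positivity
    field_simp
    ring
  rw [e1, Chebyshev.T_real_cosh, Real.cosh_eq]
  have e2 : (3 : ℝ) ≤ Real.exp (((K : ℤ) : ℝ) * Real.log ((x + 1) / (x - 1))) := by
    rw [Int.cast_natCast, ← Real.log_pow, Real.exp_log (by positivity)]
    have h1 : (x + 1) / (x - 1) = 1 + 2 / (x - 1) := by field_simp; ring
    have h2 := one_add_mul_le_pow (a := 2 / (x - 1)) (by
      have : 0 < 2 / (x - 1) := by positivity
      linarith) K
    rw [h1]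
    refine le_trans ?_ h2
    have h3 : 1 ≤ K / (x - 1) := (one_le_div hx0).2 (by linarith)
    have h4 : (K : ℝ) * (2 / (x - 1)) = 2 * (K / (x - 1)) := by ring
    linarith
  linarith [Real.exp_pos (-(((K : ℤ) : ℝ) * Real.log ((x + 1) / (x - 1))))]

theorem chebPoly_eval_zero (hlo : 0 < lo) (hle : lo ≤ hi) (hK : √(hi / lo) ≤ K) :
    (chebPoly lo hi K).eval 0 = 0 := by
  rw [chebPoly]
  split_ifs with h
  · simp
  · have h1 := three_halves_le_eval_T hlo (lt_of_le_of_ne hle h) hK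
    simp only [eval_sub, eval_one, eval_mul, eval_C, eval_comp, eval_X, mul_zero, sub_zero]
    rw [one_div_mul_cancel (by linarith), sub_self]

/-- The affine substitution maps `[lo, hi]` to `[-1, 1]`, where `|T_K| ≤ 1`; division by a number at
least `3/2` leaves a deviation from `1` of at most `2/3`. -/
theorem chebPoly_eval_mem (hlo : 0 < lo) (hle : lo ≤ hi) (hK : √(hi / lo) ≤ K) {t : ℝ}
    (ht : lo ≤ t) (ht' : t ≤ hi) :
    1 / 3 ≤ (chebPoly lo hi K).eval t ∧ (chebPoly lo hi K).eval t ≤ 5 / 3 := by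
  rw [chebPoly]
  split_ifs with h
  · subst h
    rw [le_antisymm ht' ht]
    simp only [eval_mul, eval_C, eval_X]
    rw [one_div_mul_cancel hlo.ne']
    norm_num
  · have hlt := lt_of_le_of_ne hle h
    have h1 := three_halves_le_eval_T hlo hlt hK
    simp only [eval_sub, eval_one, eval_mul, eval_C, eval_comp, eval_X]
    set τ := eval ((hi + lo) / (hi - lo)) (Chebyshev.T ℝ (K : ℤ))
    have hd : 0 < hi - lo := sub_pos.2 hlt
    have e : (hi + lo) / (hi - lo) - 2 / (hi - lo) * t = (hi + lo - 2 * t) / (hi - lo) := by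
      field_simp
    have h2 := Chebyshev.abs_eval_T_real_le_one (K : ℤ)
      (x := (hi + lo) / (hi - lo) - 2 / (hi - lo) * t) (by
        rw [e, abs_le, le_div_iff₀ hd, div_le_iff₀ hd]
        constructor <;> linarith)
    set σ := eval ((hi + lo) / (hi - lo) - 2 / (hi - lo) * t) (Chebyshev.T ℝ (K : ℤ))
    have h3 : |1 / τ * σ| ≤ 2 / 3 := by
      rw [abs_mul, abs_of_nonneg (by positivity), one_div_mul_eq_div, div_le_iff₀ (by linarith)]
      linarith
    rw [abs_le] at h3
    constructor <;> linarith [h3.1, h3.2]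

theorem natDegree_chebPoly_le (hK : 1 ≤ K) : (chebPoly lo hi K).natDegree ≤ K := by
  rw [chebPoly]
  split_ifs with h
  · exact (natDegree_C_mul_le _ _).trans (natDegree_X_le.trans hK)
  · refine (natDegree_sub_le _ _).trans (max_le (by simp) ?_)
    refine (natDegree_C_mul_le _ _).trans (natDegree_comp_le.trans ?_)
    rw [Chebyshev.natDegree_T, Int.natAbs_natCast]
    refine (Nat.mul_le_mul_left K (?_ : _ ≤ 1)).trans (by simp)
    exact (natDegree_sub_le _ _).trans
      (max_le (by simp) ((natDegree_C_mul_le _ _).trans natDegree_X_le))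

variable {n : Type} [Fintype n] [DecidableEq n] {M U : Matrix n n ℝ} {l : n → ℝ}

namespace SingDiag

theorem chebFor_eval_zero (h : SingDiag M U l) : (chebFor M).eval 0 = 0 :=
  chebPoly_eval_zero h.lamMinPos_pos h.lamMinPos_le_lamMax (Nat.le_ceil _)

theorem chebFor_eval_mem (h : SingDiag M U l) {i : n} (hi : l i ≠ 0) :
    1 / 3 ≤ (chebFor M).eval (l i) ∧ (chebFor M).eval (l i) ≤ 5 / 3 :=
  chebPoly_eval_mem h.lamMinPos_pos h.lamMinPos_le_lamMax (Nat.le_ceil _) (h.lamMinPos_le hi)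
    (h.le_lamMax i)

theorem chebFor_eval_eq_zero_iff (h : SingDiag M U l) (i : n) :
    (chebFor M).eval (l i) = 0 ↔ l i = 0 := by
  constructor
  · intro h0
    by_contra hi
    linarith [(h.chebFor_eval_mem hi).1]
  · intro h0
    rw [h0, h.chebFor_eval_zero]

theorem chebMat (h : SingDiag M U l) :
    SingDiag (chebMat M) U (fun i => (chebFor M).eval (l i)) := by
  refine ⟨h.toOrthoDiag.aeval _, fun i => ?_, ?_, ?_⟩
  · by_cases hi : l i = 0
    · rw [hi, h.chebFor_eval_zero]
    · linarith [(h.chebFor_eval_mem hi).1]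
  · obtain ⟨i, hi⟩ := h.exists_zero
    exact ⟨i, (h.chebFor_eval_eq_zero_iff i).2 hi⟩
  · obtain ⟨i, hi⟩ := h.exists_ne
    exact ⟨i, mt (h.chebFor_eval_eq_zero_iff i).1 hi⟩

/-- The extreme nonzero eigenvalues are values of the polynomial at nonzero eigenvalues of `M`, so
their ratio is at most `(5/3)/(1/3)`. -/
theorem chi_chebMat_le (h : SingDiag M U l) : chi (GloballyDual.chebMat M) ≤ 5 := by
  have h' := h.chebMat
  rw [chi, div_le_iff₀ h'.lamMinPos_pos]
  obtain ⟨i, hi⟩ := h'.lamMax_isGreatest.1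
  obtain ⟨⟨j, hj⟩, hj0⟩ := h'.lamMinPos_isLeast.1
  have h1 : l i ≠ 0 := by
    intro h0
    have := h'.lamMax_pos
    simp only [h0, h.chebFor_eval_zero] at hi
    linarith
  have h2 : l j ≠ 0 := by
    intro h0
    simp only [h0, h.chebFor_eval_zero] at hj
    exact hj0 hj.symm
  rw [← hi, ← hj]
  linarith [(h.chebFor_eval_mem h1).2, (h.chebFor_eval_mem h2).1]

theorem natDegree_chebFor_le (h : SingDiag M U l) :
    ((chebFor M).natDegree : ℝ) ≤ 2 * √(chi M) := by
  have h1 : 1 ≤ √(chi M) := Real.one_le_sqrt.2 h.one_le_chi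
  have h2 : (chebFor M).natDegree ≤ ⌈√(chi M)⌉₊ :=
    natDegree_chebPoly_le (Nat.one_le_ceil_iff.2 (by linarith))
  have h3 : ((chebFor M).natDegree : ℝ) ≤ ⌈√(chi M)⌉₊ := by exact_mod_cast h2
  linarith [Nat.ceil_lt_add_one (Real.sqrt_nonneg (chi M))]

end SingDiag

end Chebyshev

/-! ### Matrices as Euclidean maps, and the composition of a conjugate with `Gᵀ` -/

section Matrix

variable {n κ : Type} [Fintype n] [DecidableEq n]

theorem toEuclideanLin_eq_zero_iff (G : Matrix κ n ℝ) (x : Vec n) :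
    G.toEuclideanLin x = 0 ↔ G.mulVec x.ofLp = 0 := by
  simp [Matrix.toEuclideanLin, Matrix.toLpLin_apply]

theorem inner_toEuclideanLin_eq_dotProduct [Fintype κ] (N G : Matrix κ n ℝ) (x : Vec n) :
    ⟪N.toEuclideanLin x, G.toEuclideanLin x⟫ =
      dotProduct (N.mulVec x.ofLp) (G.mulVec x.ofLp) := by
  rw [Matrix.toEuclideanLin, EuclideanSpace.inner_eq_star_dotProduct, dotProduct_comm]
  rfl

theorem norm_toEuclideanLin_sq_le [Fintype κ] {G : Matrix κ n ℝ} {U : Matrix n n ℝ}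
    {l : n → ℝ} (h : SingDiag (G.transpose * G) U l) (x : Vec n) :
    ‖G.toEuclideanLin x‖ ^ 2 ≤ lamMax (G.transpose * G) * ‖x‖ ^ 2 := by
  have h1 := h.inner_mulVec_le x.ofLp
  rw [← real_inner_self_eq_norm_sq, ← real_inner_self_eq_norm_sq x,
    inner_toEuclideanLin_eq_dotProduct, EuclideanSpace.inner_eq_star_dotProduct]
  rw [← Matrix.mulVec_mulVec, Matrix.dotProduct_mulVec, Matrix.vecMul_transpose] at h1
  exact h1

variable [Fintype κ] [DecidableEq κ]

theorem inner_toEuclideanLin (G : Matrix κ n ℝ) (y : Vec κ) (x : Vec n) :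
    ⟪y, G.toEuclideanLin x⟫ = ⟪G.transpose.toEuclideanLin y, x⟫ := by
  have : G.transpose = G.conjTranspose := by simp
  rw [this, Matrix.toEuclideanLin_conjTranspose_eq_adjoint, LinearMap.adjoint_inner_left]

theorem toEuclideanLin_transpose_eq_adjoint (G : Matrix κ n ℝ) :
    G.transpose.toEuclideanLin = LinearMap.adjoint G.toEuclideanLin := by
  rw [← Matrix.toEuclideanLin_conjTranspose_eq_adjoint]
  simp

theorem toEuclideanLin_mul_apply {ι : Type} [Fintype ι] [DecidableEq ι] (N : Matrix ι κ ℝ)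
    (G : Matrix κ n ℝ) (x : Vec n) :
    (N * G).toEuclideanLin x = N.toEuclideanLin (G.toEuclideanLin x) := by
  simp [Matrix.toEuclideanLin, Matrix.toLpLin_apply, Matrix.mulVec_mulVec]

variable {G : Matrix κ n ℝ} {U : Matrix n n ℝ} {l : n → ℝ}

theorem gram_toEuclideanLin_eq_zero_iff (x : Vec n) :
    (G.transpose * G).toEuclideanLin x = 0 ↔ G.toEuclideanLin x = 0 := by
  rw [toEuclideanLin_mul_apply]
  constructor
  · intro h
    have : ⟪G.toEuclideanLin x, G.toEuclideanLin x⟫ = 0 := by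
      rw [inner_toEuclideanLin, h, inner_zero_left]
    exact inner_self_eq_zero.1 this
  · intro h
    rw [h, map_zero]

theorem mem_range_transpose_iff (p : Vec n) :
    p ∈ LinearMap.range G.transpose.toEuclideanLin ↔
      ∀ x, G.toEuclideanLin x = 0 → ⟪x, p⟫ = 0 := by
  rw [toEuclideanLin_transpose_eq_adjoint, ← LinearMap.orthogonal_ker, Submodule.mem_orthogonal]
  rfl

/-- Since `range Gᵀ = range GᵀG`, the preimage under `Gᵀ` can be taken in `range G`; this places a
dual optimum in `y₀ + range G`. -/
theorem exists_gram_eq {p : Vec n} (hp : p ∈ LinearMap.range G.transpose.toEuclideanLin) :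
    ∃ v, G.transpose.toEuclideanLin (G.toEuclideanLin v) = p := by
  rw [toEuclideanLin_transpose_eq_adjoint, ← LinearMap.range_adjoint_comp_self] at hp
  obtain ⟨v, hv⟩ := hp
  exact ⟨v, by rw [toEuclideanLin_transpose_eq_adjoint, ← hv]; rfl⟩

/-- `Gᵀ` inherits the norm bound of `G` by Cauchy–Schwarz: `‖Gᵀy‖² ≤ ‖y‖ ‖G Gᵀ y‖`. One factor
`‖Gᵀy‖` then cancels unless it is zero. -/
theorem norm_transpose_toEuclideanLin_sq_le (h : SingDiag (G.transpose * G) U l) (y : Vec κ) :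
    ‖G.transpose.toEuclideanLin y‖ ^ 2 ≤ lamMax (G.transpose * G) * ‖y‖ ^ 2 := by
  set a := ‖G.transpose.toEuclideanLin y‖
  have h1 : a ^ 2 ≤ ‖y‖ * ‖G.toEuclideanLin (G.transpose.toEuclideanLin y)‖ := by
    rw [← real_inner_self_eq_norm_sq, ← inner_toEuclideanLin]
    exact real_inner_le_norm _ _
  have h2 := norm_toEuclideanLin_sq_le h (G.transpose.toEuclideanLin y)
  set b := ‖G.toEuclideanLin (G.transpose.toEuclideanLin y)‖
  rcases (norm_nonneg (G.transpose.toEuclideanLin y)).eq_or_lt with h0 | h0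
  · change 0 = a at h0
    rw [← h0, zero_pow two_ne_zero]
    have := h.lamMax_pos
    positivity
  · change 0 < a at h0
    have h3 : (a ^ 2) ^ 2 ≤ ‖y‖ ^ 2 * (lamMax (G.transpose * G) * a ^ 2) :=
      calc (a ^ 2) ^ 2 ≤ (‖y‖ * b) ^ 2 := pow_le_pow_left₀ (by positivity) h1 2
        _ = ‖y‖ ^ 2 * b ^ 2 := by ring
        _ ≤ _ := by gcongr
    have h4 : 0 < a ^ 2 := by positivity
    refine le_of_mul_le_mul_right ?_ h4
    linarith

theorem le_norm_transpose_toEuclideanLin_sq (h : SingDiag (G.transpose * G) U l) {y : Vec κ}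
    (hy : y ∈ LinearMap.range G.toEuclideanLin) :
    lamMinPos (G.transpose * G) * ‖y‖ ^ 2 ≤ ‖G.transpose.toEuclideanLin y‖ ^ 2 := by
  obtain ⟨x, rfl⟩ := hy
  have h1 := h.inner_mulVec_le_mulVec x.ofLp
  rw [← toEuclideanLin_mul_apply, ← real_inner_self_eq_norm_sq, ← real_inner_self_eq_norm_sq,
    inner_toEuclideanLin_eq_dotProduct, inner_toEuclideanLin_eq_dotProduct]
  refine le_trans (le_of_eq ?_) h1
  rw [← Matrix.mulVec_mulVec, Matrix.dotProduct_mulVec x.ofLp, Matrix.vecMul_transpose]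

/-! ### The dual function `y ↦ f*(Gᵀ y)` -/

variable {f : Vec n → ℝ} {μ L : ℝ}

theorem conjugate_transpose_le (hμ : 0 < μ) (hf : IsStronglyConvexOn Set.univ μ f)
    (h : SingDiag (G.transpose * G) U l) (x y : Vec κ) :
    conjugate f (G.transpose.toEuclideanLin y) ≤ conjugate f (G.transpose.toEuclideanLin x) +
      ⟪G.toEuclideanLin (dualOracle f (G.transpose.toEuclideanLin x)), y - x⟫ +
        lamMax (G.transpose * G) / μ / 2 * ‖y - x‖ ^ 2 := by
  have h1 := conjugate_le_quadratic hμ hf (dualOracle f (G.transpose.toEuclideanLin x))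
    (G.transpose.toEuclideanLin y)
  rw [gradient_dualOracle hμ hf, ← map_sub] at h1
  have h2 := norm_transpose_toEuclideanLin_sq_le h (y - x)
  rw [real_inner_comm, ← inner_toEuclideanLin, real_inner_comm] at h1
  have h3 : 1 / (2 * μ) * ‖G.transpose.toEuclideanLin (y - x)‖ ^ 2 ≤
      1 / (2 * μ) * (lamMax (G.transpose * G) * ‖y - x‖ ^ 2) := by gcongr
  have h4 : 1 / (2 * μ) * (lamMax (G.transpose * G) * ‖y - x‖ ^ 2) =
      lamMax (G.transpose * G) / μ / 2 * ‖y - x‖ ^ 2 := by field_simp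
  linarith

theorem le_conjugate_transpose (hμ : 0 < μ) (hf : IsStronglyConvexOn Set.univ μ f) (hL : 0 < L)
    (hs : IsSmooth L f) (h : SingDiag (G.transpose * G) U l) (x y : Vec κ)
    (hxy : y - x ∈ LinearMap.range G.toEuclideanLin) :
    conjugate f (G.transpose.toEuclideanLin x) +
      ⟪G.toEuclideanLin (dualOracle f (G.transpose.toEuclideanLin x)), y - x⟫ +
        lamMinPos (G.transpose * G) / L / 2 * ‖y - x‖ ^ 2 ≤
      conjugate f (G.transpose.toEuclideanLin y) := by
  have h1 := quadratic_le_conjugate hμ hf hL hs (dualOracle f (G.transpose.toEuclideanLin x))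
    (G.transpose.toEuclideanLin y)
  rw [gradient_dualOracle hμ hf, ← map_sub] at h1
  have h2 := le_norm_transpose_toEuclideanLin_sq h hxy
  rw [real_inner_comm, ← inner_toEuclideanLin, real_inner_comm] at h1
  have h3 : 1 / (2 * L) * (lamMinPos (G.transpose * G) * ‖y - x‖ ^ 2) ≤
      1 / (2 * L) * ‖G.transpose.toEuclideanLin (y - x)‖ ^ 2 := by gcongr
  have h4 : 1 / (2 * L) * (lamMinPos (G.transpose * G) * ‖y - x‖ ^ 2) =
      lamMinPos (G.transpose * G) / L / 2 * ‖y - x‖ ^ 2 := by field_simp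
  linarith

theorem hasGradientAt_conjugate_transpose (hμ : 0 < μ) (hf : IsStronglyConvexOn Set.univ μ f)
    (h : SingDiag (G.transpose * G) U l) (y : Vec κ) :
    HasGradientAt (fun y => conjugate f (G.transpose.toEuclideanLin y))
      (G.toEuclideanLin (dualOracle f (G.transpose.toEuclideanLin y))) y := by
  refine hasGradientAt_of_quadratic_bound (c := lamMax (G.transpose * G) / μ / 2) fun z => ?_
  have h1 := conjugate_transpose_le hμ hf h y z
  have h2 := tangent_le_conjugate hμ hf (dualOracle f (G.transpose.toEuclideanLin y))
    (G.transpose.toEuclideanLin z)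
  rw [gradient_dualOracle hμ hf, ← map_sub, real_inner_comm, ← inner_toEuclideanLin,
    real_inner_comm] at h2
  have h3 : 0 ≤ lamMax (G.transpose * G) / μ / 2 * ‖z - y‖ ^ 2 := by
    have := h.lamMax_pos
    positivity
  rw [abs_le]
  constructor <;> linarith

/-- The recursion is linear apart from `g`, so the linear map `Gᵀ` carries one method to the other.
-/
theorem accel_transpose (g : Vec n → Vec n) (η β : ℝ) (y₀ : Vec κ) (k : ℕ) :
    G.transpose.toEuclideanLin
        (accel (fun y => G.toEuclideanLin (g (G.transpose.toEuclideanLin y))) η β y₀ k).1 =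
      (accel (fun q => (G.transpose * G).toEuclideanLin (g q)) η β
        (G.transpose.toEuclideanLin y₀) k).1 ∧
    G.transpose.toEuclideanLin
        (accel (fun y => G.toEuclideanLin (g (G.transpose.toEuclideanLin y))) η β y₀ k).2 =
      (accel (fun q => (G.transpose * G).toEuclideanLin (g q)) η β
        (G.transpose.toEuclideanLin y₀) k).2 := by
  induction k with
  | zero => exact ⟨rfl, rfl⟩
  | succ k ih =>
    refine ⟨?_, ih.1⟩
    rw [accel_succ_fst, accel_succ_fst, ← ih.1, ← ih.2, toEuclideanLin_mul_apply]
    simp only [map_add, map_sub, map_smul]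

/-- The rate of Nesterov's method on `y ↦ f*(Gᵀ y)` in terms of the dual distance to a point `xs`
of the kernel of `G` whose gradient is in the range of `Gᵀ`. -/
theorem accel_conjugate_rate (hμ : 0 < μ) (hf : IsStronglyConvexOn Set.univ μ f) (hμL : μ ≤ L)
    (hs : IsSmooth L f) (h : SingDiag (G.transpose * G) U l) {xs : Vec n}
    (hxs : G.toEuclideanLin xs = 0)
    (hps : ∇ f xs ∈ LinearMap.range G.transpose.toEuclideanLin) (y₀ : Vec κ) (k : ℕ) :
    conjugate f (G.transpose.toEuclideanLin
        (accel (fun y => G.toEuclideanLin (dualOracle f (G.transpose.toEuclideanLin y)))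
          (1 / (lamMax (G.transpose * G) / μ))
          ((√(lamMax (G.transpose * G) / μ) - √(lamMinPos (G.transpose * G) / L)) /
            (√(lamMax (G.transpose * G) / μ) + √(lamMinPos (G.transpose * G) / L))) y₀ k).1) -
        conjugate f (∇ f xs) ≤
      (1 - √(lamMinPos (G.transpose * G) / L / (lamMax (G.transpose * G) / μ))) ^ k *
        (μ * (‖G.transpose.toEuclideanLin y₀ - ∇ f xs‖ / μ) ^ 2) := by
  have hL : 0 < L := hμ.trans_le hμL
  have h1 := h.lamMinPos_pos
  have h2 := h.lamMinPos_le_lamMax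
  have h3 := h.lamMax_pos
  have hκℓ : lamMinPos (G.transpose * G) / L ≤ lamMax (G.transpose * G) / μ := by gcongr
  obtain ⟨v, hv⟩ := exists_gram_eq (p := ∇ f xs - G.transpose.toEuclideanLin y₀)
    (Submodule.sub_mem _ hps ⟨y₀, rfl⟩)
  set ys := y₀ + G.toEuclideanLin v with hys
  have hGys : G.transpose.toEuclideanLin ys = ∇ f xs := by
    rw [hys, map_add, hv]
    abel
  have hrate := accel_rate (φ := fun y => conjugate f (G.transpose.toEuclideanLin y))
    (g := fun y => G.toEuclideanLin (dualOracle f (G.transpose.toEuclideanLin y)))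
    (div_pos h1 hL) hκℓ (LinearMap.range G.toEuclideanLin) (fun x => ⟨_, rfl⟩)
    (conjugate_transpose_le hμ hf h) (le_conjugate_transpose hμ hf hL hs h) y₀ ys
    ⟨v, by rw [hys, add_sub_cancel_left]⟩ k
  simp only [hGys] at hrate
  refine hrate.trans (mul_le_mul_of_nonneg_left ?_ (pow_nonneg (sub_nonneg.2 ?_) k))
  -- The gradient vanishes at `ys`, so strong convexity there bounds the distance term by the
  -- initial gap. Smoothness bounds that gap by `‖Gᵀy₀ - ∇f(xs)‖²/(2μ)`, hence the factor `2` in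
  -- `h7`.
  · have h4 := le_conjugate_transpose hμ hf hL hs h ys y₀
      ⟨-v, by rw [hys, map_neg, sub_add_cancel_left]⟩
    rw [hGys, dualOracle_gradient hμ hf, hxs, inner_zero_left] at h4
    have h5 := conjugate_le_quadratic hμ hf xs (G.transpose.toEuclideanLin y₀)
    have h6 : ⟪xs, G.transpose.toEuclideanLin y₀ - ∇ f xs⟫ = 0 := by
      rw [← hGys, ← map_sub, real_inner_comm, ← inner_toEuclideanLin, hxs, inner_zero_right]
    rw [h6] at h5
    have h7 : μ * (‖G.transpose.toEuclideanLin y₀ - ∇ f xs‖ / μ) ^ 2 =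
        2 * (1 / (2 * μ) * ‖G.transpose.toEuclideanLin y₀ - ∇ f xs‖ ^ 2) := by
      field_simp
    rw [h7]
    linarith
  · rw [Real.sqrt_le_one]
    exact (div_le_one (div_pos h3 hμ)).2 hκℓ

end Matrix

/-! ### Block vectors -/

section Block

variable {m n : ℕ}

theorem block_apply (x : Vec (Fin m × Fin n)) (i : Fin m) (j : Fin n) : block x i j = x (i, j) :=
  rfl

/-- The vector with given blocks. -/
def col (v : Fin m → Vec (Fin n)) : Vec (Fin m × Fin n) := WithLp.toLp 2 fun k => v k.1 k.2

theorem block_col (v : Fin m → Vec (Fin n)) (i : Fin m) : block (col v) i = v i := rfl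

theorem inner_eq_sum_block (x y : Vec (Fin m × Fin n)) :
    ⟪x, y⟫ = ∑ i, ⟪block x i, block y i⟫ := by
  simp only [PiLp.inner_apply, Fintype.sum_prod_type, block_apply]

theorem norm_sq_eq_sum_block (x : Vec (Fin m × Fin n)) : ‖x‖ ^ 2 = ∑ i, ‖block x i‖ ^ 2 := by
  simp only [← real_inner_self_eq_norm_sq]
  exact inner_eq_sum_block x x

end Block

/-! ### Structure of the problem: constraint matrix, separability, optimality, dual function -/

namespace Problem

variable {m d p : ℕ} {P : Problem m d p}

theorem gram_eq (hW : P.W.IsHermitian) (γ : ℝ) :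
    P.gram γ = (1 : Matrix (Fin m) (Fin m) ℝ) ⊗ₖ P.BtB +
      γ ^ 2 • ((P.W * P.W) ⊗ₖ (1 : Matrix (Fin d) (Fin d) ℝ)) := by
  have hWt : P.W.transpose = P.W := by simpa using hW.eq
  rw [gram, A, Matrix.transpose_fromRows, Matrix.fromCols_mul_fromRows, bigB, bigW, BtB,
    Matrix.transpose_smul, Matrix.smul_mul, Matrix.mul_smul, smul_smul, ← pow_two,
    ← Matrix.kroneckerMap_transpose, ← Matrix.kroneckerMap_transpose, ← Matrix.mul_kronecker_mul,
    ← Matrix.mul_kronecker_mul, hWt]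
  simp

theorem A_toEuclideanLin_eq_zero_iff {γ : ℝ} (hγ : γ ≠ 0) (x : Vec (Fin m × Fin d)) :
    (P.A γ).toEuclideanLin x = 0 ↔ P.Feasible x := by
  rw [Feasible, toEuclideanLin_eq_zero_iff, toEuclideanLin_eq_zero_iff, toEuclideanLin_eq_zero_iff,
    A, Matrix.fromRows_mulVec, Matrix.smul_mulVec]
  constructor
  · intro h
    refine ⟨?_, ?_⟩
    · ext i
      have := congrFun h (Sum.inr i)
      simpa [hγ] using this
    · ext i
      exact congrFun h (Sum.inl i)
  · rintro ⟨h1, h2⟩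
    rw [h1, h2]
    ext (i | i) <;> simp

theorem toEuclideanLin_transpose_A (hW : P.W.IsHermitian) (γ : ℝ)
    (y : Vec (DualIdx m d p)) :
    (P.A γ).transpose.toEuclideanLin y =
      P.bigB.transpose.toEuclideanLin (WithLp.toLp 2 fun k => y (Sum.inl k)) +
        γ • P.bigW.toEuclideanLin (WithLp.toLp 2 fun k => y (Sum.inr k)) := by
  have hWt : P.W.transpose = P.W := by simpa using hW.eq
  have hbW : P.bigW.transpose = P.bigW := by
    rw [bigW, ← Matrix.kroneckerMap_transpose, hWt, Matrix.transpose_one]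
  ext i
  simp [A, Matrix.toEuclideanLin, Matrix.toLpLin_apply, Matrix.transpose_fromRows,
    hbW, Matrix.fromCols_mulVec, Matrix.smul_mulVec, Function.comp_def]

theorem block_kronecker_one {T : Matrix (Fin m) (Fin m) ℝ} (x : Vec (Fin m × Fin d)) (i : Fin m) :
    block ((T ⊗ₖ (1 : Matrix (Fin d) (Fin d) ℝ)).toEuclideanLin x) i =
      ∑ j, T i j • block x j := by
  ext k
  simp [block, Matrix.toEuclideanLin, Matrix.toLpLin_apply, Matrix.mulVec, dotProduct,
    Fintype.sum_prod_type, Matrix.one_apply]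

theorem block_one_kronecker {q r : ℕ} {S : Matrix (Fin q) (Fin r) ℝ} (x : Vec (Fin m × Fin r))
    (i : Fin m) :
    block (((1 : Matrix (Fin m) (Fin m) ℝ) ⊗ₖ S).toEuclideanLin x) i =
      S.toEuclideanLin (block x i) := by
  ext j
  simp [block, Matrix.toEuclideanLin, Matrix.toLpLin_apply, Matrix.mulVec, dotProduct,
    Fintype.sum_prod_type, Matrix.one_apply, ite_mul, Finset.sum_ite_irrel]

namespace Assumptions

theorem exists_singDiag_W (hP : P.Assumptions) : ∃ U l, SingDiag P.W U l := by
  have : NeZero m := ⟨by have := hP.two_le; omega⟩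
  refine SingDiag.exists_of_posSemidef hP.posSemidef ?_ ⟨fun _ => 1, ?_, ?_⟩
  -- If `W` vanished, the indicator of one vertex would lie in the kernel, contrary to `2 ≤ m`.
  · intro h0
    have h1 := (hP.kernel (Pi.single ⟨0, by have := hP.two_le; omega⟩ 1)).1 (by rw [h0, Matrix.zero_mulVec])
      ⟨0, by have := hP.two_le; omega⟩ ⟨1, by have := hP.two_le; omega⟩
    simp at h1
  · intro h
    have := congrFun h 0
    simp at this
  · exact (hP.kernel _).2 fun _ _ => rfl

theorem exists_singDiag_BtB (hP : P.Assumptions) : ∃ U l, SingDiag P.BtB U l := by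
  have e : P.BtB = P.B.conjTranspose * P.B := by simp [BtB]
  refine SingDiag.exists_of_posSemidef ?_ ?_ ?_
  · rw [e]
    exact Matrix.posSemidef_conjTranspose_mul_self _
  · rw [e, Ne, Matrix.conjTranspose_mul_self_eq_zero]
    exact hP.B_ne_zero
  · obtain ⟨x, hx, hx0⟩ := hP.ker_B
    exact ⟨x, hx, by rw [BtB, ← Matrix.mulVec_mulVec, hx0, Matrix.mulVec_zero]⟩

theorem μ_le_L (hP : P.Assumptions) : P.μ ≤ P.L := by
  have : NeZero m := ⟨by have := hP.two_le; omega⟩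
  obtain ⟨x, hx, -⟩ := hP.ker_B
  have : Nontrivial (Vec (Fin d)) := by
    refine ⟨WithLp.toLp 2 x, 0, fun h => hx ?_⟩
    simpa using congrArg WithLp.ofLp h
  exact le_of_stronglyConvex_of_smooth (hP.strong 0) (hP.smooth 0)

theorem L_pos (hP : P.Assumptions) : 0 < P.L := hP.μ_pos.trans_le hP.μ_le_L

theorem F_lower (hP : P.Assumptions) (x y : Vec (Fin m × Fin d)) :
    P.F x + ⟪col fun i => ∇ (P.f i) (block x i), y - x⟫ + P.μ / 2 * ‖y - x‖ ^ 2 ≤ P.F y := by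
  rw [F, F, inner_eq_sum_block, norm_sq_eq_sum_block, Finset.mul_sum, ← Finset.sum_add_distrib,
    ← Finset.sum_add_distrib]
  exact Finset.sum_le_sum fun i _ => (hP.strong i).2 (block x i) trivial (block y i) trivial

theorem F_upper (hP : P.Assumptions) (x y : Vec (Fin m × Fin d)) :
    P.F y ≤ P.F x + ⟪col fun i => ∇ (P.f i) (block x i), y - x⟫ + P.L / 2 * ‖y - x‖ ^ 2 := by
  rw [F, F, inner_eq_sum_block, norm_sq_eq_sum_block, Finset.mul_sum, ← Finset.sum_add_distrib,
    ← Finset.sum_add_distrib]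
  exact Finset.sum_le_sum fun i _ => (hP.smooth i).2 (block x i) (block y i)

theorem hasGradientAt_F (hP : P.Assumptions) (x : Vec (Fin m × Fin d)) :
    HasGradientAt P.F (col fun i => ∇ (P.f i) (block x i)) x := by
  refine hasGradientAt_of_quadratic_bound (c := P.L / 2) fun y => ?_
  have h1 := hP.F_lower x y
  have h2 := hP.F_upper x y
  have h3 : 0 ≤ P.μ / 2 * ‖y - x‖ ^ 2 := by
    have := hP.μ_pos
    positivity
  rw [abs_le]
  constructor <;> linarith

theorem gradient_F (hP : P.Assumptions) (x : Vec (Fin m × Fin d)) :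
    ∇ P.F x = col fun i => ∇ (P.f i) (block x i) := (hP.hasGradientAt_F x).gradient

theorem strong_F (hP : P.Assumptions) : IsStronglyConvexOn Set.univ P.μ P.F :=
  ⟨fun x => (hP.hasGradientAt_F x).differentiableAt, fun x _ y _ => by
    rw [hP.gradient_F]; exact hP.F_lower x y⟩

theorem smooth_F (hP : P.Assumptions) : IsSmooth P.L P.F :=
  ⟨fun x => (hP.hasGradientAt_F x).differentiableAt, fun x y => by
    rw [hP.gradient_F]; exact hP.F_upper x y⟩

/-- Separability of `F` makes `∇F` act blockwise, hence so does its inverse: the global oracle is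
one local oracle call at each node. -/
theorem block_dualOracle (hP : P.Assumptions) (q : Vec (Fin m × Fin d)) (i : Fin m) :
    block (dualOracle P.F q) i = dualOracle (P.f i) (block q i) := by
  have h := gradient_dualOracle hP.μ_pos hP.strong_F q
  rw [hP.gradient_F] at h
  conv_rhs => rw [← h, block_col]
  rw [dualOracle_gradient hP.μ_pos (hP.strong i)]

/-! ### Existence and optimality conditions -/

theorem exists_isSolution (hP : P.Assumptions) : ∃ xs, P.IsSolution xs := by
  obtain ⟨x, hx, hmin⟩ := exists_min_on_submodule hP.strong_F.1.continuous (half_pos hP.μ_pos)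
    (g := ∇ P.F 0) (c := P.F 0) (fun x => by simpa using hP.strong_F.growth 0 x)
    (LinearMap.ker P.bigW.toEuclideanLin ⊓ LinearMap.ker P.bigB.toEuclideanLin)
  exact ⟨x, hx, hmin⟩

/-- First-order optimality along the line `xs + t • v`: smoothness yields `0 ≤ t a + t² b` for every
`t`, and the minimizing `t = -a/(2b)` forces `a = 0`. -/
theorem inner_gradient_eq_zero (hP : P.Assumptions) {xs v : Vec (Fin m × Fin d)}
    (hxs : P.IsSolution xs) (hv : P.Feasible v) : ⟪v, ∇ P.F xs⟫ = 0 := by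
  rw [real_inner_comm]
  set a := ⟪∇ P.F xs, v⟫ with ha
  have hL := hP.L_pos
  -- The summand `1` keeps `b` positive also for `v = 0`.
  set b := P.L / 2 * ‖v‖ ^ 2 + 1 with hb
  have hb0 : 0 < b := by positivity
  have h1 : ∀ t : ℝ, 0 ≤ t * a + t ^ 2 * b := by
    intro t
    have hf : P.Feasible (xs + t • v) :=
      ⟨by rw [map_add, map_smul, hxs.1.1, hv.1]; simp,
        by rw [map_add, map_smul, hxs.1.2, hv.2]; simp⟩
    have h2 := hxs.2 _ hf
    have h3 := hP.smooth_F.2 xs (xs + t • v)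
    rw [add_sub_cancel_left, inner_smul_right, norm_smul, mul_pow, Real.norm_eq_abs, sq_abs,
      ← ha] at h3
    have : t ^ 2 * b = P.L / 2 * (t ^ 2 * ‖v‖ ^ 2) + t ^ 2 := by rw [hb]; ring
    nlinarith [sq_nonneg t]
  have h4 := h1 (-a / (2 * b))
  have h5 : -a / (2 * b) * a + (-a / (2 * b)) ^ 2 * b = -(a ^ 2 / (4 * b)) := by
    field_simp
    ring
  rw [h5] at h4
  have h6 : a ^ 2 / (4 * b) ≤ 0 := by linarith
  have h7 : a ^ 2 ≤ 0 := by
    by_contra! h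
    have : 0 < a ^ 2 / (4 * b) := by positivity
    linarith
  exact pow_eq_zero_iff two_ne_zero |>.1 (le_antisymm h7 (sq_nonneg a))

/-! ### The dual function -/

theorem Phi_isGreatest (hP : P.Assumptions) (γ : ℝ) (y : Vec (DualIdx m d p)) :
    IsGreatest (Set.range fun x => -P.F x + ⟪y, (P.A γ).toEuclideanLin x⟫) (P.Phi γ y) ∧
      P.Phi γ y = conjugate P.F ((P.A γ).transpose.toEuclideanLin y) := by
  have e : (fun x => -P.F x + ⟪y, (P.A γ).toEuclideanLin x⟫) =
      fun x => ⟪(P.A γ).transpose.toEuclideanLin y, x⟫ - P.F x := by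
    ext x
    rw [inner_toEuclideanLin]
    ring
  have h2 : P.Phi γ y = conjugate P.F ((P.A γ).transpose.toEuclideanLin y) := by
    rw [Phi, conjugate, e]
  refine ⟨?_, h2⟩
  rw [h2, e]
  refine ⟨⟨dualOracle P.F ((P.A γ).transpose.toEuclideanLin y), ?_⟩, ?_⟩
  · have := conjugate_gradient hP.μ_pos hP.strong_F
      (dualOracle P.F ((P.A γ).transpose.toEuclideanLin y))
    rw [gradient_dualOracle hP.μ_pos hP.strong_F] at this
    exact this.symm
  · rintro _ ⟨x, rfl⟩
    exact le_conjugate hP.μ_pos hP.strong_F _ _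

theorem Phi_eq (hP : P.Assumptions) (γ : ℝ) :
    P.Phi γ = fun y => conjugate P.F ((P.A γ).transpose.toEuclideanLin y) :=
  funext fun y => (hP.Phi_isGreatest γ y).2

theorem exists_singDiag_gram (hP : P.Assumptions) {γ : ℝ} (hγ : 0 < γ) :
    ∃ U l, SingDiag (P.gram γ) U l := by
  obtain ⟨U, l, h⟩ := hP.exists_singDiag_BtB
  obtain ⟨V, t, h'⟩ := hP.exists_singDiag_W
  rw [gram_eq hP.posSemidef.1]
  exact ⟨_, _, h.kronecker h' (by positivity)⟩

theorem hasGradientAt_Phi (hP : P.Assumptions) {γ : ℝ} (hγ : 0 < γ) (y : Vec (DualIdx m d p)) :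
    HasGradientAt (P.Phi γ)
      ((P.A γ).toEuclideanLin (dualOracle P.F ((P.A γ).transpose.toEuclideanLin y))) y := by
  obtain ⟨U, l, h⟩ := hP.exists_singDiag_gram hγ
  rw [hP.Phi_eq]
  exact hasGradientAt_conjugate_transpose hP.μ_pos hP.strong_F h y

theorem gradient_Phi (hP : P.Assumptions) {γ : ℝ} (hγ : 0 < γ) :
    ∇ (P.Phi γ) = fun y =>
      (P.A γ).toEuclideanLin (dualOracle P.F ((P.A γ).transpose.toEuclideanLin y)) :=
  gradient_eq fun y => hP.hasGradientAt_Phi hγ y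

theorem smooth_Phi (hP : P.Assumptions) {γ : ℝ} (hγ : 0 < γ) :
    IsSmooth (lamMax (P.gram γ) / P.μ) (P.Phi γ) := by
  obtain ⟨U, l, h⟩ := hP.exists_singDiag_gram hγ
  refine ⟨fun y => (hP.hasGradientAt_Phi hγ y).differentiableAt, fun x y => ?_⟩
  rw [hP.gradient_Phi hγ, hP.Phi_eq]
  exact conjugate_transpose_le hP.μ_pos hP.strong_F h x y

theorem strong_Phi (hP : P.Assumptions) {γ : ℝ} (hγ : 0 < γ) :
    IsStronglyConvexOn ((LinearMap.ker (P.A γ).transpose.toEuclideanLin)ᗮ : Set _)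
      (lamMinPos (P.gram γ) / P.L) (P.Phi γ) := by
  obtain ⟨U, l, h⟩ := hP.exists_singDiag_gram hγ
  refine ⟨fun y => (hP.hasGradientAt_Phi hγ y).differentiableAt, fun x hx y hy => ?_⟩
  rw [hP.gradient_Phi hγ, hP.Phi_eq]
  refine le_conjugate_transpose hP.μ_pos hP.strong_F hP.L_pos hP.smooth_F h x y ?_
  have := Submodule.sub_mem _ hy hx
  rw [toEuclideanLin_transpose_eq_adjoint, LinearMap.orthogonal_ker, LinearMap.adjoint_adjoint]
    at this
  exact this

end Assumptions

end Problem

theorem OrthoDiag.toEuclideanLin_eq_zero_congr {n : Type} [Fintype n] [DecidableEq n]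
    {M M' U : Matrix n n ℝ} {l l' : n → ℝ} (h : OrthoDiag M U l) (h' : OrthoDiag M' U l')
    (hl : ∀ i, l i = 0 ↔ l' i = 0) (x : Vec n) :
    M.toEuclideanLin x = 0 ↔ M'.toEuclideanLin x = 0 := by
  simp only [toEuclideanLin_eq_zero_iff, h.mulVec_eq_zero_iff, h'.mulVec_eq_zero_iff, hl]

/-- The factor `diag(√l) Uᵀ` allows any such `H` to be analysed as a Gram matrix, with no constraint
matrix behind it. -/
theorem SingDiag.exists_gram_eq {n : Type} [Fintype n] [DecidableEq n] {M U : Matrix n n ℝ}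
    {l : n → ℝ} (h : SingDiag M U l) : ∃ G : Matrix n n ℝ, M = G.transpose * G := by
  refine ⟨Matrix.diagonal (fun i => √(l i)) * U.transpose, ?_⟩
  rw [Matrix.transpose_mul, Matrix.transpose_transpose, Matrix.diagonal_transpose, mul_assoc,
    ← mul_assoc (Matrix.diagonal _), Matrix.diagonal_mul_diagonal, ← mul_assoc, h.eq]
  simp only [Real.mul_self_sqrt (h.nonneg _)]

theorem one_le_log_of_three_le {t : ℝ} (ht : 3 ≤ t) : 1 ≤ Real.log t := by
  rw [Real.le_log_iff_exp_le (by linarith)]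
  linarith [Real.exp_one_lt_d9]

/-! ### Convergence of the globally dual method and recovery of primal solutions -/

namespace Problem

variable {m d p : ℕ} {P : Problem m d p}

theorem gram_ker {γ : ℝ} (hγ : 0 < γ) (x : Vec (Fin m × Fin d)) :
    (P.gram γ).toEuclideanLin x = 0 ↔ P.Feasible x :=
  (gram_toEuclideanLin_eq_zero_iff x).trans (A_toEuclideanLin_eq_zero_iff hγ.ne' x)

theorem inner_transpose_A {γ : ℝ} (hγ : 0 < γ) (y : Vec (DualIdx m d p))
    (x : Vec (Fin m × Fin d)) (hx : P.Feasible x) :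
    ⟪x, (P.A γ).transpose.toEuclideanLin y⟫ = 0 := by
  rw [real_inner_comm, ← inner_toEuclideanLin, (A_toEuclideanLin_eq_zero_iff hγ.ne' x).2 hx,
    inner_zero_right]

namespace Assumptions

theorem three_le_scale (hP : P.Assumptions) (γ : ℝ) (p₀ xs : Vec (Fin m × Fin d)) :
    3 ≤ P.scale γ p₀ xs := by
  have h1 := hP.μ_pos
  have h2 := hP.L_pos
  have : 0 ≤ √(lamMax (P.gram γ)) * (‖p₀ - ∇ P.F xs‖ / P.μ) +
      ‖∇ P.F xs‖ * (‖p₀ - ∇ P.F xs‖ / P.μ) + P.L * (‖p₀ - ∇ P.F xs‖ / P.μ) ^ 2 := by positivity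
  rw [scale]
  linarith

theorem one_le_log_scale (hP : P.Assumptions) (γ : ℝ) (p₀ xs : Vec (Fin m × Fin d)) {ε : ℝ}
    (hε : 0 < ε) (hε1 : ε < 1) : 1 ≤ Real.log (P.scale γ p₀ xs / ε) := by
  have h1 := hP.three_le_scale γ p₀ xs
  refine one_le_log_of_three_le ?_
  rw [le_div_iff₀ hε]
  nlinarith

theorem one_le_sqrt_cond (hP : P.Assumptions) : 1 ≤ √(P.L / P.μ) :=
  Real.one_le_sqrt.2 ((one_le_div hP.μ_pos).2 hP.μ_le_L)

variable {H U : Matrix (Fin m × Fin d) (Fin m × Fin d) ℝ} {l : Fin m × Fin d → ℝ}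

theorem step_pos (hP : P.Assumptions) (h : SingDiag H U l) : 0 < P.step H :=
  one_div_pos.2 (div_pos h.lamMax_pos hP.μ_pos)

theorem momentum_pos (hP : P.Assumptions) (h : SingDiag H U l) (hlt : lamMinPos H < lamMax H) :
    0 < P.momentum H := by
  have h1 := h.lamMinPos_pos
  have h2 := h.lamMax_pos
  have h3 := hP.μ_pos
  have h4 := hP.L_pos
  have h5 : P.dualMu H < P.dualL H := by
    rw [dualMu, dualL]
    calc lamMinPos H / P.L ≤ lamMinPos H / P.μ := by gcongr; exact hP.μ_le_L
      _ < _ := by gcongr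
  have h6 : 0 < P.dualMu H := div_pos h1 h4
  have h7 : √(P.dualMu H) < √(P.dualL H) := Real.sqrt_lt_sqrt h6.le h5
  exact div_pos (sub_pos.2 h7) (add_pos_of_nonneg_of_pos (Real.sqrt_nonneg _)
    (Real.sqrt_pos.2 h6))

theorem momentum_lt_one (hP : P.Assumptions) (h : SingDiag H U l) : P.momentum H < 1 := by
  have h6 : 0 < √(P.dualMu H) := Real.sqrt_pos.2 (div_pos h.lamMinPos_pos hP.L_pos)
  have h7 := Real.sqrt_nonneg (P.dualL H)
  rw [momentum, div_lt_one (by positivity)]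
  linarith

/-- The quantity `s` is the reciprocal of `√(L/μ) √χ(H)`, and `1 - s ≤ exp (-s)`. -/
theorem rate_pow_le (hP : P.Assumptions) (h : SingDiag H U l) {t : ℝ} {k : ℕ}
    (hk : √(P.L / P.μ) * √(chi H) * t ≤ k) :
    (1 - √(P.dualMu H / P.dualL H)) ^ k ≤ Real.exp (-t) := by
  have h1 := h.lamMinPos_pos
  have h2 := h.lamMax_pos
  have h3 := hP.μ_pos
  have h4 := hP.L_pos
  set s := √(P.dualMu H / P.dualL H) with hs
  have hs0 : 0 < s := Real.sqrt_pos.2 (div_pos (div_pos h1 h4) (div_pos h2 h3))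
  have hs1 : s ≤ 1 := by
    rw [hs, Real.sqrt_le_one, dualMu, dualL, div_le_one (div_pos h2 h3)]
    have := h.lamMinPos_le_lamMax
    have := hP.μ_le_L
    gcongr
  have e : s * (√(P.L / P.μ) * √(chi H)) = 1 := by
    rw [hs, ← Real.sqrt_mul (by positivity), ← Real.sqrt_mul (by unfold dualMu dualL; positivity),
      Real.sqrt_eq_one, dualMu, dualL, chi]
    field_simp
  have h5 : t ≤ k * s := by
    have := mul_le_mul_of_nonneg_left hk hs0.le
    rw [← mul_assoc, e, one_mul] at this
    linarith
  calc (1 - s) ^ k ≤ Real.exp (-s) ^ k :=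
        pow_le_pow_left₀ (sub_nonneg.2 hs1) (Real.one_sub_le_exp_neg s) k
    _ = Real.exp (-(k * s)) := by rw [← Real.exp_nat_mul]; ring_nf
    _ ≤ _ := Real.exp_le_exp.2 (by linarith)

variable {xs p₀ : Vec (Fin m × Fin d)}

/-- With `H = GᵀG`, both `p₀` and `∇F(xs)` are orthogonal to `ker G` and so lie in `range Gᵀ`. The
iterates are then images under `Gᵀ` of Nesterov's method on `F* ∘ Gᵀ`. -/
theorem globallyDual_gap (hP : P.Assumptions) (h : SingDiag H U l)
    (hker : ∀ x, H.toEuclideanLin x = 0 ↔ P.Feasible x) (hxs : P.IsSolution xs)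
    (hp₀ : ∀ x, P.Feasible x → ⟪x, p₀⟫ = 0) (k : ℕ) :
    (∀ x, P.Feasible x → ⟪x, P.globallyDual H p₀ k⟫ = 0) ∧
    conjugate P.F (P.globallyDual H p₀ k) - conjugate P.F (∇ P.F xs) ≤
      (1 - √(P.dualMu H / P.dualL H)) ^ k * (P.μ * (‖p₀ - ∇ P.F xs‖ / P.μ) ^ 2) := by
  obtain ⟨G, rfl⟩ := h.exists_gram_eq
  have hker' : ∀ x, G.toEuclideanLin x = 0 ↔ P.Feasible x := fun x =>
    (gram_toEuclideanLin_eq_zero_iff x).symm.trans (hker x)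
  obtain ⟨y₀, rfl⟩ := (mem_range_transpose_iff (G := G) p₀).2 fun x hx => hp₀ x ((hker' x).1 hx)
  have h1 := accel_conjugate_rate hP.μ_pos hP.strong_F hP.μ_le_L hP.smooth_F h
    ((hker' xs).2 hxs.1) ((mem_range_transpose_iff (G := G) _).2 fun x hx =>
      hP.inner_gradient_eq_zero hxs ((hker' x).1 hx)) y₀ k
  rw [(accel_transpose _ _ _ _ _).1] at h1
  refine ⟨fun x hx => ?_, h1⟩
  have h2 := (accel_transpose (G := G) (dualOracle P.F) (P.step (G.transpose * G))
    (P.momentum (G.transpose * G)) y₀ k).1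
  rw [globallyDual, ← h2, real_inner_comm, ← inner_toEuclideanLin, (hker' x).2 hx, inner_zero_right]

/-- Strong duality: `∇F(xs)` is orthogonal to `xs`, so the Fenchel equality loses its bilinear term.
-/
theorem conjugate_gradient_solution (hP : P.Assumptions) (hxs : P.IsSolution xs) :
    conjugate P.F (∇ P.F xs) = -P.F xs := by
  rw [conjugate_gradient hP.μ_pos hP.strong_F, real_inner_comm, hP.inner_gradient_eq_zero hxs hxs.1]
  ring

/-- A small dual gap gives an approximate primal solution. -/
theorem epsSolution_of_gap (hP : P.Assumptions) (hxs : P.IsSolution xs) {γ : ℝ} (hγ : 0 < γ)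
    {ε : ℝ} (hε : 0 < ε) (hε1 : ε < 1) {q : Vec (Fin m × Fin d)} (hq : ⟪xs, q⟫ = 0)
    (hgap : conjugate P.F q - conjugate P.F (∇ P.F xs) ≤
      (ε / P.scale γ p₀ xs) ^ 2 / 2 * (P.μ * (‖p₀ - ∇ P.F xs‖ / P.μ) ^ 2)) :
    P.EpsSolution γ ε (dualOracle P.F q) := by
  obtain ⟨U, l, h⟩ := hP.exists_singDiag_gram hγ
  have hμ := hP.μ_pos
  have hL := hP.L_pos
  have hD := hP.three_le_scale γ p₀ xs
  have hDdef : P.scale γ p₀ xs = 3 + √(lamMax (P.gram γ)) * (‖p₀ - ∇ P.F xs‖ / P.μ) +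
    ‖∇ P.F xs‖ * (‖p₀ - ∇ P.F xs‖ / P.μ) + P.L * (‖p₀ - ∇ P.F xs‖ / P.μ) ^ 2 := rfl
  set r := ‖p₀ - ∇ P.F xs‖ / P.μ with hr
  set D := P.scale γ p₀ xs
  have hr0 : 0 ≤ r := by positivity
  set e := ε / D with he
  have he0 : 0 < e := by positivity
  have he1 : e ≤ 1 := (div_le_one (by linarith)).2 (by linarith)
  have heD : e * D = ε := div_mul_cancel₀ _ (by linarith)
  set x := dualOracle P.F q
  have h1 := norm_dualOracle_sub_sq_le hμ hP.strong_F q xs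
  rw [real_inner_comm, hq] at h1
  rw [hP.conjugate_gradient_solution hxs] at hgap
  have h2 : ‖x - xs‖ ^ 2 ≤ (e * r) ^ 2 := by
    have : P.μ / 2 * ‖x - xs‖ ^ 2 ≤ P.μ / 2 * (e * r) ^ 2 := by
      refine h1.trans ?_
      have : P.μ / 2 * (e * r) ^ 2 = e ^ 2 / 2 * (P.μ * r ^ 2) := by ring
      linarith
    exact le_of_mul_le_mul_left this (by positivity)
  -- Every nonconstant term of `scale` is a sensitivity to a displacement of size `r`; shrinking the
  -- displacement by `e = ε / D` brings each error below `e * D = ε`.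
  have h3 : ‖x - xs‖ ≤ e * r :=
    (pow_le_pow_iff_left₀ (norm_nonneg _) (by positivity) two_ne_zero).1 h2
  have hs0 := Real.sqrt_nonneg (lamMax (P.gram γ))
  have hn0 := norm_nonneg (∇ P.F xs)
  have n1 := mul_nonneg hs0 hr0
  have n2 := mul_nonneg hn0 hr0
  have n3 : 0 ≤ P.L * r ^ 2 := by positivity
  refine ⟨fun z hz => ?_, ?_⟩
  · have h4 := hP.smooth_F.2 xs x
    have h5 : ⟪∇ P.F xs, x - xs⟫ ≤ ‖∇ P.F xs‖ * (e * r) :=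
      (real_inner_le_norm _ _).trans (by gcongr)
    have h6 : P.L / 2 * ‖x - xs‖ ^ 2 ≤ e * (P.L * r ^ 2) := by
      calc P.L / 2 * ‖x - xs‖ ^ 2 ≤ P.L / 2 * (e * r) ^ 2 := by gcongr
        _ = e * (e * (P.L * r ^ 2)) / 2 := by ring
        _ ≤ e * (1 * (P.L * r ^ 2)) / 1 := by gcongr; norm_num
        _ = _ := by ring
    have h7 : ‖∇ P.F xs‖ * (e * r) + e * (P.L * r ^ 2) ≤ e * D := by
      have : e * (‖∇ P.F xs‖ * r + P.L * r ^ 2) ≤ e * D :=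
        mul_le_mul_of_nonneg_left (by linarith) he0.le
      linarith
    linarith [hxs.2 z hz]
  · have h4 : (P.A γ).toEuclideanLin x = (P.A γ).toEuclideanLin (x - xs) := by
      rw [map_sub, (A_toEuclideanLin_eq_zero_iff hγ.ne' xs).2 hxs.1, sub_zero]
    have h5 : ‖(P.A γ).toEuclideanLin (x - xs)‖ ≤ √(lamMax (P.gram γ)) * ‖x - xs‖ := by
      refine (pow_le_pow_iff_left₀ (norm_nonneg _) (by positivity) two_ne_zero).1 ?_
      rw [mul_pow, Real.sq_sqrt h.lamMax_pos.le]
      exact norm_toEuclideanLin_sq_le h _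
    rw [h4]
    calc _ ≤ √(lamMax (P.gram γ)) * (e * r) := h5.trans (by gcongr)
      _ = e * (√(lamMax (P.gram γ)) * r) := by ring
      _ ≤ e * D := mul_le_mul_of_nonneg_left (by linarith) he0.le
      _ = ε := heD

/-- The factor `3` yields the contraction `(ε/D)³`. Two powers are needed by `epsSolution_of_gap`,
and the third supplies its `1/2`, since `D ≥ 3` and `ε < 1`. -/
theorem epsSolution_globallyDual (hP : P.Assumptions) (h : SingDiag H U l)
    (hker : ∀ x, H.toEuclideanLin x = 0 ↔ P.Feasible x) (hxs : P.IsSolution xs)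
    (hp₀ : ∀ x, P.Feasible x → ⟪x, p₀⟫ = 0) {γ : ℝ} (hγ : 0 < γ) {ε : ℝ} (hε : 0 < ε)
    (hε1 : ε < 1) {k : ℕ}
    (hk : √(P.L / P.μ) * √(chi H) * (3 * Real.log (P.scale γ p₀ xs / ε)) ≤ k) :
    P.EpsSolution γ ε (dualOracle P.F (P.globallyDual H p₀ k)) := by
  obtain ⟨h1, h2⟩ := hP.globallyDual_gap h hker hxs hp₀ k
  refine hP.epsSolution_of_gap hxs hγ hε hε1 (h1 xs hxs.1) (h2.trans ?_) (p₀ := p₀)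
  have hμ := hP.μ_pos
  have hD := hP.three_le_scale γ p₀ xs
  refine mul_le_mul_of_nonneg_right ((hP.rate_pow_le h hk).trans ?_) (by positivity)
  have hq : 0 < P.scale γ p₀ xs / ε := by positivity
  have e1 : Real.exp (-(3 * Real.log (P.scale γ p₀ xs / ε))) = (ε / P.scale γ p₀ xs) ^ 3 := by
    rw [← mul_neg, ← Real.log_inv, inv_div, mul_comm, Real.exp_mul, Real.exp_log (by positivity)]
    norm_cast
  rw [e1]
  have e2 : ε / P.scale γ p₀ xs ≤ 1 / 2 := by
    rw [div_le_iff₀ (by linarith)]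
    linarith
  calc (ε / P.scale γ p₀ xs) ^ 3 = (ε / P.scale γ p₀ xs) ^ 2 * (ε / P.scale γ p₀ xs) := by ring
    _ ≤ (ε / P.scale γ p₀ xs) ^ 2 * (1 / 2) := by gcongr
    _ = _ := by ring

/-! ### The method with the matrix `Aᵀ A` -/

theorem transpose_A_fastDual (hP : P.Assumptions) {γ : ℝ} (hγ : 0 < γ)
    (y₀ : Vec (DualIdx m d p)) (k : ℕ) :
    (P.A γ).transpose.toEuclideanLin (P.fastDual γ y₀ k) =
      P.globallyDual (P.gram γ) ((P.A γ).transpose.toEuclideanLin y₀) k := by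
  rw [fastDual, hP.gradient_Phi hγ]
  exact (accel_transpose (G := P.A γ) (dualOracle P.F) _ _ y₀ k).1

theorem fastDual_gap_le (hP : P.Assumptions) {γ : ℝ} (hγ : 0 < γ) (hxs : P.IsSolution xs)
    (y₀ : Vec (DualIdx m d p)) {ε : ℝ} (hε : 0 < ε) {k : ℕ}
    (hk : √(P.L / P.μ) * √(chi (P.gram γ)) *
      Real.log (P.scale γ ((P.A γ).transpose.toEuclideanLin y₀) xs / ε) ≤ k)
    (y : Vec (DualIdx m d p)) : P.Phi γ (P.fastDual γ y₀ k) - P.Phi γ y ≤ ε := by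
  obtain ⟨U, l, h⟩ := hP.exists_singDiag_gram hγ
  have hμ := hP.μ_pos
  set p₀ := (P.A γ).transpose.toEuclideanLin y₀ with hp₀
  have hD := hP.three_le_scale γ p₀ xs
  have h1 := (hP.globallyDual_gap h (gram_ker hγ) hxs
    (fun x hx => inner_transpose_A hγ y₀ x hx) k).2
  -- Weak duality: every value of `Φ` is at least `-F(xs)`, so the gap to `∇F(xs)` bounds the gap to
  -- any `y`.
  have h2 := le_conjugate hμ hP.strong_F ((P.A γ).transpose.toEuclideanLin y) xs
  rw [real_inner_comm, inner_transpose_A hγ y xs hxs.1] at h2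
  rw [hP.conjugate_gradient_solution hxs] at h1
  rw [hP.Phi_eq]
  simp only [hP.transpose_A_fastDual hγ]
  have h3 : (1 - √(P.dualMu (P.gram γ) / P.dualL (P.gram γ))) ^ k *
      (P.μ * (‖p₀ - ∇ P.F xs‖ / P.μ) ^ 2) ≤ ε := by
    have h4 := hP.rate_pow_le h hk
    rw [Real.exp_neg, Real.exp_log (by positivity), inv_div] at h4
    have h5 : P.μ * (‖p₀ - ∇ P.F xs‖ / P.μ) ^ 2 ≤ P.scale γ p₀ xs := by
      have h6 : P.μ * (‖p₀ - ∇ P.F xs‖ / P.μ) ^ 2 ≤ P.L * (‖p₀ - ∇ P.F xs‖ / P.μ) ^ 2 := by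
        gcongr
        exact hP.μ_le_L
      have h7 : 0 ≤ √(lamMax (P.gram γ)) * (‖p₀ - ∇ P.F xs‖ / P.μ) +
        ‖∇ P.F xs‖ * (‖p₀ - ∇ P.F xs‖ / P.μ) := by positivity
      rw [scale]
      linarith
    calc _ ≤ ε / P.scale γ p₀ xs * P.scale γ p₀ xs :=
          mul_le_mul h4 h5 (by positivity) (by positivity)
      _ = ε := div_mul_cancel₀ _ (by linarith)
  linarith

theorem lamMinPos_lt_lamMax_gram (hP : P.Assumptions) {γ : ℝ} (hγ : 0 < γ) :
    lamMinPos (P.gram γ) < lamMax (P.gram γ) := by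
  obtain ⟨U, l, h⟩ := hP.exists_singDiag_BtB
  obtain ⟨V, t, h'⟩ := hP.exists_singDiag_W
  rw [gram_eq hP.posSemidef.1]
  exact h.lamMinPos_lt_lamMax_kronecker h' (by positivity)

theorem chi_gram (hP : P.Assumptions) {γ : ℝ} (hγ : 0 < γ) :
    chi (P.gram γ) = (lamMax P.BtB + γ ^ 2 * lamMax P.W ^ 2) /
      min (lamMinPos P.BtB) (γ ^ 2 * lamMinPos P.W ^ 2) := by
  obtain ⟨U, l, h⟩ := hP.exists_singDiag_BtB
  obtain ⟨V, t, h'⟩ := hP.exists_singDiag_W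
  rw [gram_eq hP.posSemidef.1, chi, h.lamMax_kronecker h' (by positivity),
    h.lamMinPos_kronecker h' (by positivity)]

theorem gammaOpt_pos (hP : P.Assumptions) : 0 < P.gammaOpt := by
  obtain ⟨U, l, h⟩ := hP.exists_singDiag_BtB
  obtain ⟨V, t, h'⟩ := hP.exists_singDiag_W
  exact div_pos (Real.sqrt_pos.2 h.lamMinPos_pos) h'.lamMinPos_pos

theorem chi_gram_gammaOpt (hP : P.Assumptions) :
    chi (P.gram P.gammaOpt) = chi P.BtB + chi P.W ^ 2 := by
  obtain ⟨U, l, h⟩ := hP.exists_singDiag_BtB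
  obtain ⟨V, t, h'⟩ := hP.exists_singDiag_W
  rw [gram_eq hP.posSemidef.1]
  refine h.chi_kronecker_balanced h' ?_
  rw [gammaOpt, div_pow, Real.sq_sqrt h.lamMinPos_pos.le]

/-- The quotient splits into two fractions. Bounding the common minimum by its first or its second
argument gives `chi BtB` and `chi W ^ 2`. -/
theorem chi_gram_gammaOpt_le (hP : P.Assumptions) {γ : ℝ} (hγ : 0 < γ) :
    chi (P.gram P.gammaOpt) ≤ chi (P.gram γ) := by
  obtain ⟨U, l, h⟩ := hP.exists_singDiag_BtB
  obtain ⟨V, t, h'⟩ := hP.exists_singDiag_W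
  have h1 := h.lamMinPos_pos
  have h2 := h'.lamMinPos_pos
  have h3 := h.lamMax_pos
  have h4 := h'.lamMax_pos
  have hm : 0 < min (lamMinPos P.BtB) (γ ^ 2 * lamMinPos P.W ^ 2) := lt_min h1 (by positivity)
  rw [hP.chi_gram_gammaOpt, hP.chi_gram hγ, add_div, chi, chi]
  refine add_le_add ?_ ?_
  · gcongr
    exact min_le_left _ _
  · calc (lamMax P.W / lamMinPos P.W) ^ 2 =
        γ ^ 2 * lamMax P.W ^ 2 / (γ ^ 2 * lamMinPos P.W ^ 2) := by field_simp
      _ ≤ _ := by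
        gcongr
        exact min_le_right _ _

/-! ### The method with Chebyshev acceleration -/

theorem exists_singDiag_chebGram (hP : P.Assumptions) : ∃ U l, SingDiag P.chebGram U l ∧
    lamMinPos P.chebGram < lamMax P.chebGram ∧ chi P.chebGram ≤ 30 ∧
    ∀ x, P.chebGram.toEuclideanLin x = 0 ↔ P.Feasible x := by
  obtain ⟨U, l, h⟩ := hP.exists_singDiag_BtB
  obtain ⟨V, t, h'⟩ := hP.exists_singDiag_W
  have hc : 0 < lamMinPos (chebMat P.BtB) / lamMinPos (chebMat P.W) ^ 2 :=
    div_pos h.chebMat.lamMinPos_pos (pow_pos h'.chebMat.lamMinPos_pos 2)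
  have hk := h.chebMat.kronecker h'.chebMat hc
  refine ⟨_, _, hk, h.chebMat.lamMinPos_lt_lamMax_kronecker h'.chebMat hc, ?_, fun x => ?_⟩
  · rw [chebGram, h.chebMat.chi_kronecker_balanced h'.chebMat rfl]
    have h1 := h.chi_chebMat_le
    have h2 := h'.chi_chebMat_le
    nlinarith [h'.chebMat.one_le_chi]
  -- Feasibility is the kernel of `gram γ` for any positive `γ`; here `γ = 1`. That matrix shares
  -- its eigenvectors with `chebGram`, and the polynomials vanish on the spectra exactly at `0`.
  · have hk' := h.kronecker h' (c := (1 : ℝ) ^ 2) (by norm_num)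
    rw [← gram_eq hP.posSemidef.1] at hk'
    rw [← gram_ker one_pos]
    refine hk.toOrthoDiag.toEuclideanLin_eq_zero_congr hk'.toOrthoDiag (fun i => ?_) x
    have n1 := h.chebMat.nonneg i.2
    have n2 := h.nonneg i.2
    rw [add_eq_zero_iff_of_nonneg n1 (by positivity), add_eq_zero_iff_of_nonneg n2 (by positivity),
      h.chebFor_eval_eq_zero_iff, mul_eq_zero_iff_left hc.ne', mul_eq_zero_iff_left (by norm_num),
      pow_eq_zero_iff two_ne_zero, pow_eq_zero_iff two_ne_zero, h'.chebFor_eval_eq_zero_iff]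

end Assumptions

end Problem

/-! ### The cost model: which vectors the nodes can hold, and at what price -/

variable {m d p : ℕ}

/-- The memory `s'` holds everything that `s` holds. -/
structure Memory.Le (s s' : Memory m d p) : Prop where
  primal : ∀ i, s.primal i ≤ s'.primal i
  aux : ∀ i, s.aux i ≤ s'.aux i

theorem Memory.Le.refl (s : Memory m d p) : s.Le s := ⟨fun _ => le_rfl, fun _ => le_rfl⟩

theorem Memory.Le.trans {s s' s'' : Memory m d p} (h : s.Le s') (h' : s'.Le s'') : s.Le s'' :=
  ⟨fun i => (h.primal i).trans (h'.primal i), fun i => (h.aux i).trans (h'.aux i)⟩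

/-- Every node stores its block of `x`. -/
def Memory.Holds (s : Memory m d p) (x : Vec (Fin m × Fin d)) : Prop :=
  ∀ i, block x i ∈ s.primal i

/-- Every node stores its block of `t` among its vectors of `ℝ^p`. -/
def Memory.HoldsAux (s : Memory m d p) (t : Vec (Fin m × Fin p)) : Prop :=
  ∀ i, block t i ∈ s.aux i

namespace Memory

variable {s s' : Memory m d p}

theorem Holds.mono {x : Vec (Fin m × Fin d)} (hx : s.Holds x) (h : s.Le s') : s'.Holds x :=
  fun i => h.primal i (hx i)

theorem HoldsAux.mono {t : Vec (Fin m × Fin p)} (ht : s.HoldsAux t) (h : s.Le s') :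
    s'.HoldsAux t := fun i => h.aux i (ht i)

theorem Holds.add {x y : Vec (Fin m × Fin d)} (hx : s.Holds x) (hy : s.Holds y) :
    s.Holds (x + y) := fun i => (s.primal i).add_mem (hx i) (hy i)

theorem Holds.sub {x y : Vec (Fin m × Fin d)} (hx : s.Holds x) (hy : s.Holds y) :
    s.Holds (x - y) := fun i => (s.primal i).sub_mem (hx i) (hy i)

theorem Holds.smul {x : Vec (Fin m × Fin d)} (hx : s.Holds x) (c : ℝ) : s.Holds (c • x) :=
  fun i => (s.primal i).smul_mem c (hx i)

theorem HoldsAux.add {x y : Vec (Fin m × Fin p)} (hx : s.HoldsAux x) (hy : s.HoldsAux y) :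
    s.HoldsAux (x + y) := fun i => (s.aux i).add_mem (hx i) (hy i)

theorem HoldsAux.sub {x y : Vec (Fin m × Fin p)} (hx : s.HoldsAux x) (hy : s.HoldsAux y) :
    s.HoldsAux (x - y) := fun i => (s.aux i).sub_mem (hx i) (hy i)

theorem HoldsAux.smul {x : Vec (Fin m × Fin p)} (hx : s.HoldsAux x) (c : ℝ) :
    s.HoldsAux (c • x) := fun i => (s.aux i).smul_mem c (hx i)

end Memory

section Run

variable {P : Problem m d p} {s₀ s : Memory m d p} {a c b : ℕ}

theorem Run.exists_dualOracle (hP : P.Assumptions) (h : Run P s₀ s a c b)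
    {q : Vec (Fin m × Fin d)} (hq : s.Holds q) :
    ∃ s', Run P s₀ s' (a + 1) c b ∧ s.Le s' ∧ s'.Holds (dualOracle P.F q) := by
  refine ⟨_, h.oracle (fun i => block q i) hq, ⟨fun i => le_sup_left, fun i => le_rfl⟩,
    fun i => ?_⟩
  rw [hP.block_dualOracle]
  exact Submodule.mem_sup_right (Submodule.mem_span_singleton_self _)

/-- Row `i` of `W` involves only node `i` itself and its neighbours, so one exchange suffices. -/
theorem Run.exists_bigW (hP : P.Assumptions) (h : Run P s₀ s a c b) {x : Vec (Fin m × Fin d)}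
    (hx : s.Holds x) :
    ∃ s', Run P s₀ s' a (c + 1) b ∧ s.Le s' ∧ s'.Holds (P.bigW.toEuclideanLin x) := by
  refine ⟨_, h.comm (fun i => block x i) hx, ⟨fun i => le_sup_left, fun i => le_rfl⟩,
    fun i => ?_⟩
  rw [Problem.bigW, Problem.block_kronecker_one]
  refine Submodule.sum_mem _ fun j _ => ?_
  by_cases hij : i = j
  · subst hij
    exact Submodule.smul_mem _ _ (Submodule.mem_sup_left (hx i))
  · by_cases hadj : P.graph.Adj i j
    · exact Submodule.smul_mem _ _
        (Submodule.mem_sup_right (Submodule.subset_span ⟨j, hadj, rfl⟩))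
    · rw [hP.compatible i j hij hadj, zero_smul]
      exact Submodule.zero_mem _

theorem Run.exists_bigB (h : Run P s₀ s a c b) {x : Vec (Fin m × Fin d)} (hx : s.Holds x) :
    ∃ s', Run P s₀ s' a c (b + 1) ∧ s.Le s' ∧ s'.HoldsAux (P.bigB.toEuclideanLin x) := by
  refine ⟨_, h.mulB (fun i => block x i) hx, ⟨fun i => le_rfl, fun i => le_sup_left⟩,
    fun i => ?_⟩
  rw [Problem.bigB, Problem.block_one_kronecker]
  exact Submodule.mem_sup_right (Submodule.mem_span_singleton_self _)

theorem Run.exists_bigB_transpose (h : Run P s₀ s a c b) {t : Vec (Fin m × Fin p)}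
    (ht : s.HoldsAux t) :
    ∃ s', Run P s₀ s' a c (b + 1) ∧ s.Le s' ∧ s'.Holds (P.bigB.transpose.toEuclideanLin t) := by
  refine ⟨_, h.mulBT (fun i => block t i) ht, ⟨fun i => le_sup_left, fun i => le_rfl⟩,
    fun i => ?_⟩
  rw [Problem.bigB, ← Matrix.kroneckerMap_transpose, Matrix.transpose_one,
    Problem.block_one_kronecker]
  exact Submodule.mem_sup_right (Submodule.mem_span_singleton_self _)

/-! ### Linear operators that the network can apply -/

/-- From any memory that holds `x`, the network can compute `T x` with `c₁` communications and `b₁`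
multiplications by `B` or `Bᵀ`. -/
def Applies (P : Problem m d p) (T : Module.End ℝ (Vec (Fin m × Fin d))) (c₁ b₁ : ℕ) : Prop :=
  ∀ ⦃s₀ s : Memory m d p⦄ ⦃a c b : ℕ⦄ ⦃x : Vec (Fin m × Fin d)⦄, Run P s₀ s a c b → s.Holds x →
    ∃ s', Run P s₀ s' a (c + c₁) (b + b₁) ∧ s.Le s' ∧ s'.Holds (T x)

variable {T T' : Module.End ℝ (Vec (Fin m × Fin d))} {c₁ b₁ c₂ b₂ : ℕ}

theorem Applies.mul (h : Applies P T c₁ b₁) (h' : Applies P T' c₂ b₂) :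
    Applies P (T * T') (c₁ + c₂) (b₁ + b₂) := by
  intro s₀ s a c b x hr hx
  obtain ⟨s₁, hr₁, hle₁, hx₁⟩ := h' hr hx
  obtain ⟨s₂, hr₂, hle₂, hx₂⟩ := h hr₁ hx₁
  refine ⟨s₂, ?_, hle₁.trans hle₂, hx₂⟩
  rwa [add_comm c₁, add_comm b₁, ← add_assoc, ← add_assoc]

theorem Applies.add (h : Applies P T c₁ b₁) (h' : Applies P T' c₂ b₂) :
    Applies P (T + T') (c₁ + c₂) (b₁ + b₂) := by
  intro s₀ s a c b x hr hx
  obtain ⟨s₁, hr₁, hle₁, hx₁⟩ := h hr hx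
  obtain ⟨s₂, hr₂, hle₂, hx₂⟩ := h' hr₁ (hx.mono hle₁)
  refine ⟨s₂, ?_, hle₁.trans hle₂, (hx₁.mono hle₂).add hx₂⟩
  rwa [← add_assoc, ← add_assoc]

theorem Applies.smul (h : Applies P T c₁ b₁) (r : ℝ) : Applies P (r • T) c₁ b₁ := by
  intro s₀ s a c b x hr hx
  obtain ⟨s₁, hr₁, hle₁, hx₁⟩ := h hr hx
  exact ⟨s₁, hr₁, hle₁, hx₁.smul r⟩

/-- Horner's scheme. -/
theorem Applies.aeval (h : Applies P T c₁ b₁) {K : ℕ} {q : Polynomial ℝ} (hq : q.natDegree ≤ K) :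
    Applies P (Polynomial.aeval T q) (K * c₁) (K * b₁) := by
  induction K generalizing q with
  | zero =>
    intro s₀ s a c b x hr hx
    rw [Polynomial.eq_C_of_natDegree_le_zero hq]
    refine ⟨s, by simpa using hr, Memory.Le.refl s, ?_⟩
    rw [Polynomial.aeval_C, Module.algebraMap_end_apply]
    exact hx.smul _
  | succ K ih =>
    intro s₀ s a c b x hr hx
    obtain ⟨s₁, hr₁, hle₁, hx₁⟩ := h hr hx
    have hdeg : q.divX.natDegree ≤ K := by
      rw [Polynomial.natDegree_divX_eq_natDegree_tsub_one]
      omega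
    obtain ⟨s₂, hr₂, hle₂, hx₂⟩ := ih hdeg hr₁ hx₁
    refine ⟨s₂, ?_, hle₁.trans hle₂, ?_⟩
    · convert hr₂ using 1 <;> ring
    -- Here `q(T) x = divX(q)(T) (T x) + q(0) x`, and the memory still holds `x` at the end.
    · conv => rw [← Polynomial.divX_mul_X_add q]
      rw [map_add, map_mul, Polynomial.aeval_X, Polynomial.aeval_C, LinearMap.add_apply,
        Module.algebraMap_end_apply]
      exact hx₂.add ((hx.mono (hle₁.trans hle₂)).smul _)

theorem Problem.Assumptions.applies_bigW (hP : P.Assumptions) :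
    Applies P P.bigW.toEuclideanLin 1 0 := fun _ _ _ _ _ _ hr hx => hr.exists_bigW hP hx

theorem applies_one_kronecker_BtB :
    Applies P ((1 : Matrix (Fin m) (Fin m) ℝ) ⊗ₖ P.BtB).toEuclideanLin 0 2 := by
  intro s₀ s a c b x hr hx
  obtain ⟨s₁, hr₁, hle₁, hx₁⟩ := hr.exists_bigB hx
  obtain ⟨s₂, hr₂, hle₂, hx₂⟩ := hr₁.exists_bigB_transpose hx₁
  refine ⟨s₂, hr₂, hle₁.trans hle₂, ?_⟩
  rw [← toEuclideanLin_mul_apply] at hx₂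
  convert hx₂ using 3
  rw [Problem.bigB, ← Matrix.kroneckerMap_transpose, ← Matrix.mul_kronecker_mul]
  simp [Problem.BtB]

theorem toEuclideanLin_aeval {n : Type} [Fintype n] [DecidableEq n] (M : Matrix n n ℝ)
    (q : Polynomial ℝ) : (Polynomial.aeval M q).toEuclideanLin =
      Polynomial.aeval (M.toEuclideanLin : Module.End ℝ (Vec n)) q := by
  have hpow : ∀ k : ℕ, (M ^ k).toEuclideanLin = (M.toEuclideanLin : Module.End ℝ (Vec n)) ^ k := by
    intro k
    induction k with
    | zero =>
      ext x
      simp [Matrix.toEuclideanLin]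
    | succ k ih =>
      rw [pow_succ, pow_succ, ← ih]
      exact LinearMap.ext fun x => toEuclideanLin_mul_apply _ _ x
  rw [Polynomial.aeval_eq_sum_range, Polynomial.aeval_eq_sum_range, map_sum]
  simp only [map_smul, hpow]

theorem aeval_kronecker_one {n n' : Type} [Fintype n] [DecidableEq n] [Fintype n']
    [DecidableEq n'] (M : Matrix n n ℝ) (q : Polynomial ℝ) :
    (Polynomial.aeval M q) ⊗ₖ (1 : Matrix n' n' ℝ) =
      Polynomial.aeval (M ⊗ₖ (1 : Matrix n' n' ℝ)) q := by
  induction q using Polynomial.induction_on' with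
  | add q r hq hr => rw [map_add, map_add, Matrix.add_kronecker, hq, hr]
  | monomial k t =>
    have hpow : (M ⊗ₖ (1 : Matrix n' n' ℝ)) ^ k = (M ^ k) ⊗ₖ (1 : Matrix n' n' ℝ) := by
      induction k with
      | zero => simp
      | succ k ih => rw [pow_succ, ih, ← Matrix.mul_kronecker_mul, ← pow_succ, mul_one]
    rw [Polynomial.aeval_monomial, Polynomial.aeval_monomial, ← Algebra.smul_def,
      ← Algebra.smul_def, hpow, Matrix.smul_kronecker]

theorem one_kronecker_aeval {n n' : Type} [Fintype n] [DecidableEq n] [Fintype n']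
    [DecidableEq n'] (M : Matrix n n ℝ) (q : Polynomial ℝ) :
    (1 : Matrix n' n' ℝ) ⊗ₖ (Polynomial.aeval M q) =
      Polynomial.aeval ((1 : Matrix n' n' ℝ) ⊗ₖ M) q := by
  induction q using Polynomial.induction_on' with
  | add q r hq hr => rw [map_add, map_add, Matrix.kronecker_add, hq, hr]
  | monomial k t =>
    have hpow : ((1 : Matrix n' n' ℝ) ⊗ₖ M) ^ k = (1 : Matrix n' n' ℝ) ⊗ₖ (M ^ k) := by
      induction k with
      | zero => simp
      | succ k ih => rw [pow_succ, ih, ← Matrix.mul_kronecker_mul, ← pow_succ, mul_one]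
    rw [Polynomial.aeval_monomial, Polynomial.aeval_monomial, ← Algebra.smul_def,
      ← Algebra.smul_def, hpow, Matrix.kronecker_smul]

/-- The filtered `W` is applied twice, at one communication per degree. The filtered `BᵀB` is
applied once, at two multiplications per degree. -/
theorem Problem.Assumptions.applies_chebGram (hP : P.Assumptions) :
    Applies P P.chebGram.toEuclideanLin (2 * (chebFor P.W).natDegree)
      (2 * (chebFor P.BtB).natDegree) := by
  have hB := (applies_one_kronecker_BtB (P := P)).aeval (le_refl (chebFor P.BtB).natDegree)
  have hW := hP.applies_bigW.aeval (le_refl (chebFor P.W).natDegree)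
  rw [← toEuclideanLin_aeval, ← one_kronecker_aeval] at hB
  rw [← toEuclideanLin_aeval, Problem.bigW, ← aeval_kronecker_one] at hW
  have h := hB.add ((hW.mul hW).smul (lamMinPos (chebMat P.BtB) / lamMinPos (chebMat P.W) ^ 2))
  have e : P.chebGram.toEuclideanLin =
      ((1 : Matrix (Fin m) (Fin m) ℝ) ⊗ₖ chebMat P.BtB).toEuclideanLin +
        (lamMinPos (chebMat P.BtB) / lamMinPos (chebMat P.W) ^ 2) •
          ((chebMat P.W ⊗ₖ (1 : Matrix (Fin d) (Fin d) ℝ)).toEuclideanLin *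
            (chebMat P.W ⊗ₖ (1 : Matrix (Fin d) (Fin d) ℝ)).toEuclideanLin :
            Module.End ℝ (Vec (Fin m × Fin d))) := by
    rw [Problem.chebGram, map_add, map_smul]
    congr 2
    refine LinearMap.ext fun x => ?_
    rw [Module.End.mul_apply, ← toEuclideanLin_mul_apply, ← Matrix.mul_kronecker_mul, mul_one]
  rw [e]
  convert h using 1
  · rfl
  all_goals ring

/-! ### Running the methods -/

/-- Each iteration uses one oracle call; one more turns `p^N` into the primal point. -/
theorem Problem.Assumptions.computes_globallyDual (hP : P.Assumptions)
    {H : Matrix (Fin m × Fin d) (Fin m × Fin d) ℝ} (hH : Applies P H.toEuclideanLin c₁ b₁)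
    (p₀ : Vec (Fin m × Fin d)) (N : ℕ) :
    Computes P (primalMemory p p₀) (dualOracle P.F (P.globallyDual H p₀ N)) (N + 1) (N * c₁)
      (N * b₁) := by
  have key : ∀ k, ∃ s, Run P (primalMemory p p₀) s k (k * c₁) (k * b₁) ∧
      s.Holds (accel (fun q => H.toEuclideanLin (dualOracle P.F q)) (P.step H) (P.momentum H)
        p₀ k).1 ∧
      s.Holds (accel (fun q => H.toEuclideanLin (dualOracle P.F q)) (P.step H) (P.momentum H)
        p₀ k).2 := by
    intro k
    induction k with
    | zero =>
      have h0 : (primalMemory p p₀).Holds p₀ := fun i => Submodule.mem_span_singleton_self _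
      exact ⟨_, by simpa using Run.init, h0, h0⟩
    | succ k ih =>
      obtain ⟨s, hr, h1, h2⟩ := ih
      have hz := h1.add ((h1.sub h2).smul (P.momentum H))
      obtain ⟨s₁, hr₁, hle₁, hx₁⟩ := hr.exists_dualOracle hP hz
      obtain ⟨s₂, hr₂, hle₂, hx₂⟩ := hH hr₁ hx₁
      refine ⟨s₂, ?_, (hz.mono (hle₁.trans hle₂)).sub (hx₂.smul _), h1.mono (hle₁.trans hle₂)⟩
      rwa [Nat.succ_mul, Nat.succ_mul]
  obtain ⟨s, hr, h1, -⟩ := key N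
  obtain ⟨s₁, hr₁, -, hx₁⟩ := hr.exists_dualOracle hP h1
  exact ⟨s₁, hr₁, hx₁⟩

/-- Node `i` stores the `i`-th blocks of both components of `y`. -/
def Memory.HoldsDual (s : Memory m d p) (y : Vec (Problem.DualIdx m d p)) : Prop :=
  s.Holds (WithLp.toLp 2 fun k => y (Sum.inr k)) ∧ s.HoldsAux (WithLp.toLp 2 fun k => y (Sum.inl k))

namespace Memory.HoldsDual

variable {s' : Memory m d p} {x y : Vec (Problem.DualIdx m d p)}

theorem mono (hx : s.HoldsDual x) (h : s.Le s') : s'.HoldsDual x := ⟨hx.1.mono h, hx.2.mono h⟩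

theorem add (hx : s.HoldsDual x) (hy : s.HoldsDual y) : s.HoldsDual (x + y) :=
  ⟨hx.1.add hy.1, hx.2.add hy.2⟩

theorem sub (hx : s.HoldsDual x) (hy : s.HoldsDual y) : s.HoldsDual (x - y) :=
  ⟨hx.1.sub hy.1, hx.2.sub hy.2⟩

theorem smul (hx : s.HoldsDual x) (c : ℝ) : s.HoldsDual (c • x) := ⟨hx.1.smul c, hx.2.smul c⟩

end Memory.HoldsDual

theorem Run.exists_transpose_A (hP : P.Assumptions) (h : Run P s₀ s a c b) (γ : ℝ)
    {y : Vec (Problem.DualIdx m d p)} (hy : s.HoldsDual y) :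
    ∃ s', Run P s₀ s' a (c + 1) (b + 1) ∧ s.Le s' ∧
      s'.Holds ((P.A γ).transpose.toEuclideanLin y) := by
  obtain ⟨s₁, hr₁, hle₁, hx₁⟩ := h.exists_bigW hP hy.1
  obtain ⟨s₂, hr₂, hle₂, hx₂⟩ := hr₁.exists_bigB_transpose (hy.2.mono hle₁)
  refine ⟨s₂, hr₂, hle₁.trans hle₂, ?_⟩
  rw [Problem.toEuclideanLin_transpose_A hP.posSemidef.1]
  exact hx₂.add ((hx₁.mono hle₂).smul γ)

theorem Run.exists_A (hP : P.Assumptions) (h : Run P s₀ s a c b) (γ : ℝ)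
    {x : Vec (Fin m × Fin d)} (hx : s.Holds x) :
    ∃ s', Run P s₀ s' a (c + 1) (b + 1) ∧ s.Le s' ∧ s'.HoldsDual ((P.A γ).toEuclideanLin x) := by
  obtain ⟨s₁, hr₁, hle₁, hx₁⟩ := h.exists_bigW hP hx
  obtain ⟨s₂, hr₂, hle₂, hx₂⟩ := hr₁.exists_bigB (hx.mono hle₁)
  refine ⟨s₂, hr₂, hle₁.trans hle₂, ?_, ?_⟩
  · convert (hx₁.mono hle₂).smul γ using 1
    ext k
    simp [Problem.A, Matrix.toEuclideanLin, Matrix.toLpLin_apply, Matrix.fromRows_mulVec,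
      Matrix.smul_mulVec]
  · convert hx₂ using 1
    ext k
    simp [Problem.A, Matrix.toEuclideanLin, Matrix.toLpLin_apply, Matrix.fromRows_mulVec]

/-- An iteration applies `Aᵀ` and `A`, each at one communication and one multiplication; the output
needs a final `Aᵀ` and oracle call. -/
theorem Problem.Assumptions.computes_fastDual (hP : P.Assumptions) {γ : ℝ} (hγ : 0 < γ)
    (y₀ : Vec (Problem.DualIdx m d p)) (N : ℕ) :
    Computes P (dualMemory y₀)
      (dualOracle P.F ((P.A γ).transpose.toEuclideanLin (P.fastDual γ y₀ N)))
      (N + 1) (2 * N + 1) (2 * N + 1) := by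
  have key : ∀ k, ∃ s, Run P (dualMemory y₀) s k (2 * k) (2 * k) ∧
      s.HoldsDual (accel (∇ (P.Phi γ)) (P.step (P.gram γ)) (P.momentum (P.gram γ)) y₀ k).1 ∧
      s.HoldsDual (accel (∇ (P.Phi γ)) (P.step (P.gram γ)) (P.momentum (P.gram γ)) y₀ k).2 := by
    intro k
    induction k with
    | zero =>
      have h0 : (dualMemory y₀).HoldsDual y₀ :=
        ⟨fun i => Submodule.mem_span_singleton_self _, fun i => Submodule.mem_span_singleton_self _⟩
      exact ⟨_, Run.init, h0, h0⟩
    | succ k ih =>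
      obtain ⟨s, hr, h1, h2⟩ := ih
      have hz := h1.add ((h1.sub h2).smul (P.momentum (P.gram γ)))
      obtain ⟨s₁, hr₁, hle₁, hx₁⟩ := hr.exists_transpose_A hP γ hz
      obtain ⟨s₂, hr₂, hle₂, hx₂⟩ := hr₁.exists_dualOracle hP hx₁
      obtain ⟨s₃, hr₃, hle₃, hx₃⟩ := hr₂.exists_A hP γ hx₂
      have hle := hle₁.trans (hle₂.trans hle₃)
      refine ⟨s₃, hr₃, ?_, h1.mono hle⟩
      rw [accel_succ_fst, congrFun (hP.gradient_Phi hγ)]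
      exact (hz.mono hle).sub (hx₃.smul _)
  obtain ⟨s, hr, h1, -⟩ := key N
  obtain ⟨s₁, hr₁, -, hx₁⟩ := hr.exists_transpose_A hP γ h1
  obtain ⟨s₂, hr₂, -, hx₂⟩ := hr₁.exists_dualOracle hP hx₁
  exact ⟨s₂, hr₂, hx₂⟩

end Run

/-! ### Complexity -/

/-- The `3` is the one in `epsSolution_globallyDual`; the rounding is absorbed because `X ≥ 1`. -/
theorem exists_nat_between {X : ℝ} (hX : 1 ≤ X) : ∃ N : ℕ, 3 * X ≤ N ∧ (N : ℝ) ≤ 4 * X :=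
  ⟨⌈3 * X⌉₊, Nat.le_ceil _, by linarith [Nat.ceil_lt_add_one (by linarith : 0 ≤ 3 * X)]⟩

namespace Problem.Assumptions

variable {P : Problem m d p} {xs : Vec (Fin m × Fin d)}

theorem fastDual_complexity (hP : P.Assumptions) (hxs : P.IsSolution xs)
    (y₀ : Vec (DualIdx m d p)) {ε : ℝ} (hε : 0 < ε) (hε1 : ε < 1) :
    ∃ N a c b : ℕ,
      (∀ k ≥ N, P.EpsSolution P.gammaOpt ε (dualOracle P.F
        ((P.A P.gammaOpt).transpose.toEuclideanLin (P.fastDual P.gammaOpt y₀ k)))) ∧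
      Computes P (dualMemory y₀) (dualOracle P.F
        ((P.A P.gammaOpt).transpose.toEuclideanLin (P.fastDual P.gammaOpt y₀ N))) a c b ∧
      ((max (max N a) (max c b) : ℕ) : ℝ) ≤
        100 * √(P.L / P.μ) * √(chi P.BtB + chi P.W ^ 2) * Real.log
          (P.scale P.gammaOpt ((P.A P.gammaOpt).transpose.toEuclideanLin y₀) xs / ε) := by
  have hγ := hP.gammaOpt_pos
  obtain ⟨U, l, h⟩ := hP.exists_singDiag_gram hγ
  have h1 := hP.one_le_log_scale P.gammaOpt ((P.A P.gammaOpt).transpose.toEuclideanLin y₀) xs hε hε1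
  have h2 := hP.one_le_sqrt_cond
  have h3 : 1 ≤ √(chi (P.gram P.gammaOpt)) := Real.one_le_sqrt.2 h.one_le_chi
  rw [← hP.chi_gram_gammaOpt]
  set lg := Real.log
    (P.scale P.gammaOpt ((P.A P.gammaOpt).transpose.toEuclideanLin y₀) xs / ε) with hlg
  have hX : 1 ≤ √(P.L / P.μ) * √(chi (P.gram P.gammaOpt)) * lg :=
    one_le_mul_of_one_le_of_one_le (one_le_mul_of_one_le_of_one_le h2 h3) h1
  obtain ⟨N, hN, hN'⟩ := exists_nat_between hX
  refine ⟨N, N + 1, 2 * N + 1, 2 * N + 1, fun k hk => ?_, hP.computes_fastDual hγ y₀ N, ?_⟩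
  · rw [hP.transpose_A_fastDual hγ]
    refine hP.epsSolution_globallyDual h (gram_ker hγ) hxs
      (fun x hx => inner_transpose_A hγ y₀ x hx) hγ hε hε1 ?_
    have : (N : ℝ) ≤ k := by exact_mod_cast hk
    rw [← hlg]
    linarith
  · have e : max (max N (N + 1)) (max (2 * N + 1) (2 * N + 1)) = 2 * N + 1 := by omega
    rw [e]
    push_cast
    linarith

theorem chebyshev_complexity (hP : P.Assumptions) (hxs : P.IsSolution xs)
    {p₀ : Vec (Fin m × Fin d)}
    (hp₀ : p₀ ∈ LinearMap.range (P.A P.gammaOpt).transpose.toEuclideanLin) {ε : ℝ} (hε : 0 < ε)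
    (hε1 : ε < 1) :
    ∃ N a c b : ℕ,
      (∀ k ≥ N, P.EpsSolution P.gammaOpt ε (dualOracle P.F (P.globallyDual P.chebGram p₀ k))) ∧
      Computes P (primalMemory p p₀) (dualOracle P.F (P.globallyDual P.chebGram p₀ N)) a c b ∧
      ((max N a : ℕ) : ℝ) ≤ 100 * √(P.L / P.μ) * Real.log (P.scale P.gammaOpt p₀ xs / ε) ∧
      (c : ℝ) ≤ 100 * a * √(chi P.W) ∧ (b : ℝ) ≤ 100 * a * √(chi P.BtB) := by
  have hγ := hP.gammaOpt_pos
  obtain ⟨U, l, h, -, hchi, hker⟩ := hP.exists_singDiag_chebGram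
  obtain ⟨_, _, hW⟩ := hP.exists_singDiag_W
  obtain ⟨_, _, hB⟩ := hP.exists_singDiag_BtB
  have h1 := hP.one_le_log_scale P.gammaOpt p₀ xs hε hε1
  have h2 := hP.one_le_sqrt_cond
  have h3 : 1 ≤ √(chi P.chebGram) := Real.one_le_sqrt.2 h.one_le_chi
  -- From `chi ≤ 30 ≤ 6²`; here the condition number of the constraints leaves the iteration count.
  have h4 : √(chi P.chebGram) ≤ 6 := Real.sqrt_le_iff.2 ⟨by norm_num, by linarith⟩
  set lg := Real.log (P.scale P.gammaOpt p₀ xs / ε) with hlg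
  have hX : 1 ≤ √(P.L / P.μ) * √(chi P.chebGram) * lg :=
    one_le_mul_of_one_le_of_one_le (one_le_mul_of_one_le_of_one_le h2 h3) h1
  have hX' : √(P.L / P.μ) * √(chi P.chebGram) * lg ≤ 6 * (√(P.L / P.μ) * lg) := by
    have : √(P.L / P.μ) * √(chi P.chebGram) * lg ≤ √(P.L / P.μ) * 6 * lg := by gcongr
    linarith
  obtain ⟨N, hN, hN'⟩ := exists_nat_between hX
  have cost : ∀ {D : ℕ} {t : ℝ}, (D : ℝ) ≤ 2 * t → 0 ≤ t →
      ((N * (2 * D) : ℕ) : ℝ) ≤ 100 * (N + 1 : ℕ) * t := by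
    intro D t hD ht
    push_cast
    have : (N : ℝ) * (2 * D) ≤ N * (2 * (2 * t)) := by gcongr
    nlinarith [mul_nonneg (Nat.cast_nonneg (α := ℝ) N) ht]
  refine ⟨N, N + 1, _, _, fun k hk => ?_, hP.computes_globallyDual hP.applies_chebGram p₀ N, ?_,
    cost hW.natDegree_chebFor_le (Real.sqrt_nonneg _),
    cost hB.natDegree_chebFor_le (Real.sqrt_nonneg _)⟩
  · refine hP.epsSolution_globallyDual h hker hxs (fun x hx => ?_) hγ hε hε1 ?_
    · obtain ⟨y, rfl⟩ := hp₀
      exact inner_transpose_A hγ y x hx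
    · have : (N : ℝ) ≤ k := by exact_mod_cast hk
      rw [← hlg]
      linarith
  · rw [max_eq_right (Nat.le_succ N)]
    push_cast
    linarith

end Problem.Assumptions

end GloballyDual

end

open GloballyDual in
theorem mainTheorem3 :
    ∃ C : ℝ, 0 < C ∧ ∀ (m d p : ℕ) (P : Problem m d p), P.Assumptions →
    ∃ xs : Vec (Fin m × Fin d), P.IsSolution xs ∧
    -- the dual oracle of `F` is the unique maximizer of `⟨q, x⟩ - F x`
    (∀ q z : Vec (Fin m × Fin d),
      IsMaxOn (fun x => ⟪q, x⟫ - P.F x) Set.univ z ↔ z = dualOracle P.F q) ∧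
    -- the dual function: well defined, its gradient, smoothness and strong convexity
    (∀ γ : ℝ, 0 < γ →
      (∀ y, IsGreatest (Set.range fun x => -P.F x + ⟪y, (P.A γ).toEuclideanLin x⟫) (P.Phi γ y) ∧
        P.Phi γ y = conjugate P.F ((P.A γ).transpose.toEuclideanLin y) ∧
        HasGradientAt (P.Phi γ)
          ((P.A γ).toEuclideanLin (dualOracle P.F ((P.A γ).transpose.toEuclideanLin y))) y) ∧
      IsSmooth (lamMax (P.gram γ) / P.μ) (P.Phi γ) ∧
      IsStronglyConvexOn ((LinearMap.ker (P.A γ).transpose.toEuclideanLin)ᗮ : Set _)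
        (lamMinPos (P.gram γ) / P.L) (P.Phi γ)) ∧
    -- the fast gradient method on the dual function, and its form in the variables `Aᵀ y`
    (∀ γ : ℝ, 0 < γ → ∀ y₀ : Vec (Problem.DualIdx m d p),
      (∀ ε : ℝ, 0 < ε → ε < 1 → ∀ k : ℕ,
        C * √(P.L / P.μ) * √(chi (P.gram γ)) *
            Real.log (P.scale γ ((P.A γ).transpose.toEuclideanLin y₀) xs / ε) ≤ k →
        ∀ y, P.Phi γ (P.fastDual γ y₀ k) - P.Phi γ y ≤ ε) ∧
      0 < P.step (P.gram γ) ∧ 0 < P.momentum (P.gram γ) ∧ P.momentum (P.gram γ) < 1 ∧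
      ∀ k, (P.A γ).transpose.toEuclideanLin (P.fastDual γ y₀ k) =
        P.globallyDual (P.gram γ) ((P.A γ).transpose.toEuclideanLin y₀) k) ∧
    -- the condition number of `Aᵀ A` and its minimum over `γ`
    (∀ γ : ℝ, 0 < γ → chi (P.gram γ) =
      (lamMax P.BtB + γ ^ 2 * lamMax P.W ^ 2) /
        min (lamMinPos P.BtB) (γ ^ 2 * lamMinPos P.W ^ 2)) ∧
    0 < P.gammaOpt ∧
    chi (P.gram P.gammaOpt) = chi P.BtB + chi P.W ^ 2 ∧
    (∀ γ : ℝ, 0 < γ → chi (P.gram P.gammaOpt) ≤ chi (P.gram γ)) ∧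
    -- complexity of the fast gradient method on the dual function
    (∀ (y₀ : Vec (Problem.DualIdx m d p)) (ε : ℝ), 0 < ε → ε < 1 →
      ∃ N a c b : ℕ,
        (∀ k ≥ N, P.EpsSolution P.gammaOpt ε (dualOracle P.F
          ((P.A P.gammaOpt).transpose.toEuclideanLin (P.fastDual P.gammaOpt y₀ k)))) ∧
        Computes P (dualMemory y₀) (dualOracle P.F
          ((P.A P.gammaOpt).transpose.toEuclideanLin (P.fastDual P.gammaOpt y₀ N))) a c b ∧
        ((max (max N a) (max c b) : ℕ) : ℝ) ≤
          C * √(P.L / P.μ) * √(chi P.BtB + chi P.W ^ 2) * Real.log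
            (P.scale P.gammaOpt ((P.A P.gammaOpt).transpose.toEuclideanLin y₀) xs / ε)) ∧
    -- the Chebyshev polynomials
    (((chebFor P.W).natDegree : ℝ) ≤ C * √(chi P.W) ∧ chi (chebMat P.W) ≤ C ∧
      ((chebFor P.BtB).natDegree : ℝ) ≤ C * √(chi P.BtB) ∧ chi (chebMat P.BtB) ≤ C) ∧
    -- complexity of the globally dual method with Chebyshev acceleration
    (0 < P.step P.chebGram ∧ 0 < P.momentum P.chebGram ∧ P.momentum P.chebGram < 1) ∧
    (∀ p₀ ∈ LinearMap.range (P.A P.gammaOpt).transpose.toEuclideanLin,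
      ∀ ε : ℝ, 0 < ε → ε < 1 →
      ∃ N a c b : ℕ,
        (∀ k ≥ N, P.EpsSolution P.gammaOpt ε (dualOracle P.F (P.globallyDual P.chebGram p₀ k))) ∧
        Computes P (primalMemory p p₀)
          (dualOracle P.F (P.globallyDual P.chebGram p₀ N)) a c b ∧
        ((max N a : ℕ) : ℝ) ≤
          C * √(P.L / P.μ) * Real.log (P.scale P.gammaOpt p₀ xs / ε) ∧
        (c : ℝ) ≤ C * a * √(chi P.W) ∧
        (b : ℝ) ≤ C * a * √(chi P.BtB)) := by
  -- A generous common constant: the largest demand, `N + 1 ≤ 5 * 6 * √(L/μ) * log(D/ε)`, comes from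
  -- the accelerated method.
  refine ⟨100, by norm_num, fun m d p P hP => ?_⟩
  obtain ⟨xs, hxs⟩ := hP.exists_isSolution
  obtain ⟨U, l, hBtB⟩ := hP.exists_singDiag_BtB
  obtain ⟨V, t, hW⟩ := hP.exists_singDiag_W
  obtain ⟨_, _, hcheb, hlt, -, -⟩ := hP.exists_singDiag_chebGram
  refine ⟨xs, hxs, fun q z => ?_, fun γ hγ => ⟨fun y => ?_, hP.smooth_Phi hγ, hP.strong_Phi hγ⟩,
    fun γ hγ y₀ => ?_, fun γ hγ => hP.chi_gram hγ, hP.gammaOpt_pos, hP.chi_gram_gammaOpt,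
    fun γ hγ => hP.chi_gram_gammaOpt_le hγ,
    fun y₀ ε hε hε1 => hP.fastDual_complexity hxs y₀ hε hε1,
    ⟨?_, hW.chi_chebMat_le.trans (by norm_num), ?_, hBtB.chi_chebMat_le.trans (by norm_num)⟩,
    ⟨hP.step_pos hcheb, hP.momentum_pos hcheb hlt, hP.momentum_lt_one hcheb⟩,
    fun p₀ hp₀ ε hε hε1 => hP.chebyshev_complexity hxs hp₀ hε hε1⟩
  · rw [isMaxOn_iff_gradient_eq hP.μ_pos hP.strong_F]
    constructor
    · rintro rfl
      exact (dualOracle_gradient hP.μ_pos hP.strong_F z).symm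
    · rintro rfl
      exact gradient_dualOracle hP.μ_pos hP.strong_F q
  · exact ⟨(hP.Phi_isGreatest γ y).1, (hP.Phi_isGreatest γ y).2, hP.hasGradientAt_Phi hγ y⟩
  · obtain ⟨_, _, h⟩ := hP.exists_singDiag_gram hγ
    refine ⟨fun ε hε hε1 k hk y => hP.fastDual_gap_le hγ hxs y₀ hε (le_trans ?_ hk) y,
      hP.step_pos h, hP.momentum_pos h (hP.lamMinPos_lt_lamMax_gram hγ), hP.momentum_lt_one h,
      hP.transpose_A_fastDual hγ y₀⟩
    have h1 := hP.one_le_log_scale γ ((P.A γ).transpose.toEuclideanLin y₀) xs hε hε1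
    have h2 : 0 ≤ √(P.L / P.μ) * √(chi (P.gram γ)) *
      Real.log (P.scale γ ((P.A γ).transpose.toEuclideanLin y₀) xs / ε) := by positivity
    linarith
  · linarith [hW.natDegree_chebFor_le, Real.sqrt_nonneg (chi P.W)]
  · linarith [hBtB.natDegree_chebFor_le, Real.sqrt_nonneg (chi P.BtB)]
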